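/- Let $(M,h)$ be a Riemannian $2$-sphere of revolution: a compact smooth Riemannian surface, homeomorphic to the $2$-sphere, with a point $p$ (a pole) such that any two points $q_1,q_2$ with $d_h(p,q_1)=d_h(p,q_2)$ satisfy $f(q_1)=q_2$ for some $h$-isometry $f$ of $M$ with $f(p)=p$. Let $p,q$ be a pair of poles, i.e. each of the two points is the unique cut point of the other, and let $(r,\theta)$ be geodesic polar coordinates around $p$ on $M\setminus\{p,q\}$, with $0<r<d_h(p,q)$. Extend $\partial/\partial\theta$ by $0$ to the poles, put $m=\sqrt{h(\partial/\partial\theta,\partial/\partial\theta)}$, let $\mu$ be a real constant with $|\mu|\,m<1$ on $M$, and let $W=\mu\,\partial/\partial\theta$. Let $$F(x,y)=\frac{\sqrt{\lambda\,h(y,y)+h(W,y)^2}-h(W,y)}{\lambda},\qquad \lambda=1-h(W,W),$$ be the Randers metric on $M$ with navigation data $(h,W)$. For $\Phi=F$ or $\Phi=\sqrt{h}$, a $\Phi$-unit-speed geodesic is a $C^\infty$ curve $c$ with $\Phi(c,\dot c)=1$ that locally minimizes the length $\int\Phi(\sigma,\dot\sigma)\,dt$ among piecewise $C^\infty$ curves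 $\sigma$ with the same initial point and the same end point. Let $\varphi_s:M\to M$ be the rotation $(r,\theta)\mapsto(r,\theta+\mu s)$, fixing $p$ and $q$. Then: (1) $(s,x)\mapsto\varphi_s(x)$ is $C^\infty$ on $\mathbb{R}\times M$ and is the flow of $W$, and every $\varphi_s$ is an $h$-isometry (so $W$ is a Killing field of $h$). (2) For every $\varepsilon>0$, a curve $\mathcal P:(-\varepsilon,\varepsilon)\to M$ is an $F$-unit-speed geodesic if and only if $\mathcal P(s)=\varphi_s(\gamma(s))$ for all $s\in(-\varepsilon,\varepsilon)$, for some $h$-unit-speed geodesic $\gamma:(-\varepsilon,\varepsilon)\to M$. (3) In particular, in polar coordinates, for functions $r:(-\varepsilon,\varepsilon)\to(0,d_h(p,q))$ and $\theta:(-\varepsilon,\varepsilon)\to\mathbb{R}$, the curve $\mathcal P(s)=(r(s),\theta(s)+\mu s)$ is an $F$-unit-speed geodesic if and only if $\gamma(s)=(r(s),\theta(s))$ is an $h$-unit-speed geodesic. -/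

import Mathlib

open Set Bundle
open scoped Manifold ContDiff

/-! Surfaces are smooth real manifolds modelled on the real plane, which is written as `ℂ`
(regarded only as a real normed space), so that `r * exp (θ * I)` is the point of the plane with
polar coordinates `(r, θ)`. -/

noncomputable section

section Curves

variable {M : Type*} [TopologicalSpace M] [ChartedSpace ℂ M]

/-- The tangent vector of a curve `γ` at time `t`. -/
def velocity (γ : ℝ → M) (t : ℝ) : TangentSpace 𝓘(ℝ, ℂ) (γ t) :=
  mfderiv 𝓘(ℝ, ℝ) 𝓘(ℝ, ℂ) γ t (1 : ℝ)

/-- The integral length `∫ F(γ, γ')` of `γ` on `[a, b]`, for a function `F` on the tangent bundle. -/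
def curveLength (F : (x : M) → TangentSpace 𝓘(ℝ, ℂ) x → ℝ) (γ : ℝ → M) (a b : ℝ) : ℝ :=
  ∫ t in a..b, F (γ t) (velocity γ t)

/-- `γ` is a piecewise `C^∞` curve on `[a, b]`: there is a subdivision
`a = τ 0 ≤ τ 1 ≤ … ≤ τ n = b` such that `γ` is `C^∞` on each closed piece (one-sided at its ends).
In particular `γ` is continuous on `[a, b]`. -/
def IsPiecewiseSmooth (γ : ℝ → M) (a b : ℝ) : Prop :=
  ∃ (n : ℕ) (τ : ℕ → ℝ), Monotone τ ∧ τ 0 = a ∧ τ n = b ∧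
    ∀ i < n, ContMDiffOn 𝓘(ℝ, ℝ) 𝓘(ℝ, ℂ) ∞ γ (Icc (τ i) (τ (i + 1)))

/-- On `[a, b]` the curve `γ` minimizes the length `curveLength F` among all piecewise `C^∞` curves
with the same initial point and the same end point. -/
def IsMinimizingOn (F : (x : M) → TangentSpace 𝓘(ℝ, ℂ) x → ℝ) (γ : ℝ → M) (a b : ℝ) : Prop :=
  ∀ (σ : ℝ → M) (c d : ℝ), c < d → IsPiecewiseSmooth σ c d → σ c = γ a → σ d = γ b →
    curveLength F γ a b ≤ curveLength F σ c d

/-- `γ` is an `F`-unit-speed geodesic on the open set `J` of parameters: it is `C^∞`, satisfies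
`F(γ, γ') = 1`, and is locally length-minimizing. -/
structure IsUnitSpeedGeodesic (F : (x : M) → TangentSpace 𝓘(ℝ, ℂ) x → ℝ) (γ : ℝ → M)
    (J : Set ℝ) : Prop where
  smooth : ContMDiffOn 𝓘(ℝ, ℝ) 𝓘(ℝ, ℂ) ∞ γ J
  unit_speed : ∀ s ∈ J, F (γ s) (velocity γ s) = 1
  locally_minimizing : ∀ s₀ ∈ J, ∃ δ > 0, ∀ s₁ ∈ J, ∀ s₂ ∈ J,
    s₀ - δ < s₁ → s₁ < s₂ → s₂ < s₀ + δ → IsMinimizingOn F γ s₁ s₂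

/-- The point with polar coordinates `(r, θ)` in the chart `E`. -/
def polarPoint (E : OpenPartialHomeomorph M ℂ) (r θ : ℝ) : M :=
  E.symm (r * Complex.exp (θ * Complex.I))

open Classical in
/-- The rotation `(r, θ) ↦ (r, θ + t)` in the polar coordinates of the chart `E`; it fixes the
points outside the chart. -/
def polarRotation (E : OpenPartialHomeomorph M ℂ) (t : ℝ) (x : M) : M :=
  if x ∈ E.source then E.symm (Complex.exp (t * Complex.I) * E x) else x

/-- The coordinate vector field `∂/∂θ` of the polar coordinates of `E`: at `x` it is the tangent
vector at `t = 0` of the curve `t ↦ polarRotation E t x`, which passes through `x` at `t = 0`.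
It vanishes at the centre and outside the chart. -/
def angularField (E : OpenPartialHomeomorph M ℂ) (x : M) : TangentSpace 𝓘(ℝ, ℂ) x :=
  velocity (fun t : ℝ => polarRotation E t x) 0

end Curves

section Riemannian

variable {M : Type*} [MetricSpace M] [ChartedSpace ℂ M]
  [RiemannianBundle (fun x : M => TangentSpace 𝓘(ℝ, ℂ) x)]

/-- The norm `√h(v, v)` of the Riemannian metric `h` of `M`. -/
def riemannianNorm (x : M) (v : TangentSpace 𝓘(ℝ, ℂ) x) : ℝ := ‖v‖

/-- The Randers metric obtained by Zermelo navigation from the Riemannian metric `h` of `M` and the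
wind `W`: `F(x, v) = (√(lam h(v, v) + W₀²) - W₀) / lam` with `lam = 1 - h(W, W)`,
`W₀ = h(W, v)`. -/
def randersMetric (W : (x : M) → TangentSpace 𝓘(ℝ, ℂ) x) (x : M)
    (v : TangentSpace 𝓘(ℝ, ℂ) x) : ℝ :=
  (√((1 - ‖W x‖ ^ 2) * ‖v‖ ^ 2 + (inner ℝ (W x) v) ^ 2) - inner ℝ (W x) v) / (1 - ‖W x‖ ^ 2)

/-- `f` is an isometry of the Riemannian metric of `M`. -/
def PreservesMetric (f : M → M) : Prop :=
  ∀ (x : M) (v : TangentSpace 𝓘(ℝ, ℂ) x), ‖mfderiv 𝓘(ℝ, ℂ) 𝓘(ℝ, ℂ) f x v‖ = ‖v‖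

/-- The Riemannian surface `M` is a 2-sphere of revolution with pole `p`: it is compact,
homeomorphic to the 2-sphere, and any two points at the same distance from `p` are exchanged by an
isometry of `M` that fixes `p`. -/
structure IsSphereOfRevolution (p : M) : Prop where
  compact : CompactSpace M
  homeo_sphere : Nonempty (M ≃ₜ Metric.sphere (0 : EuclideanSpace ℝ (Fin 3)) 1)
  pole : ∀ q₁ q₂ : M, dist p q₁ = dist p q₂ →
    ∃ f : M ≃ₘ^∞⟮𝓘(ℝ, ℂ), 𝓘(ℝ, ℂ)⟯ M, PreservesMetric f ∧ f p = p ∧ f q₁ = q₂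

/-- `q` is the unique cut point of `p`, and `E` is a geodesic normal chart around `p` on the
complement of the cut locus `{q}` of `p`: `E` maps `M \ {q}` diffeomorphically to the disc of
radius `dist p q`, and the rays of the disc correspond to minimal unit-speed geodesics from `p`.
The polar coordinates of `E` are then the geodesic polar coordinates `(r, θ)` around `p`. -/
structure IsGeodesicPolarChart (p q : M) (E : OpenPartialHomeomorph M ℂ) : Prop where
  smooth : E ∈ IsManifold.maximalAtlas 𝓘(ℝ, ℂ) ∞ M
  ne : p ≠ q
  source_eq : E.source = {q}ᶜ
  target_eq : E.target = Metric.ball 0 (dist p q)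
  center : E p = 0
  ray_unit_speed : ∀ θ : ℝ, ∀ s ∈ Ico 0 (dist p q),
    ‖velocity (fun r : ℝ => polarPoint E r θ) s‖ = 1
  ray_minimal : ∀ θ : ℝ, ∀ s ∈ Ico 0 (dist p q), dist p (polarPoint E s θ) = s

end Riemannian

end

/-! ### Velocities, isometries and the length metric -/

section

open Filter Topology Manifold

section Curves

variable {M : Type*} [TopologicalSpace M] [ChartedSpace ℂ M]

/-! The proof has two independent halves. Rotations are isometries. Since `dist p` is 1-Lipschitz
and equals the radius in the chart, an isometry fixing `p` must send rays to rays, so it is linear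
and orthogonal in the chart (`exists_linear_of_preservesMetric`). The isometries given by
`IsSphereOfRevolution` are therefore rotations or reflections there, and composing them yields every
rotation. Joint smoothness at `q` is read off in the chart centred at `q`, where the rotations are
linear as well (`contMDiff_polarRotation`). Navigation. `randersMetric W x v` is the time `f` with
`‖v - f • W x‖ = f`. As the flow preserves both `h` and `W`, moving a unit-speed curve along it
turns `h`-speed one into `F`-speed one and conversely. Along such curves length is elapsed time, so
it remains to carry a too short competitor over to the other metric
(`IsNavigation.exists_moved_curve`). The competitor is not reparametrized by arc length, which fails
where it stops; it is moved by the flow at a smooth clock `T` whose rate approximates its speed plus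
a constant surplus. The surplus makes the end points match, and since the wind is slower than some
`w < 1`, it costs less length than the time it uses up. -/

lemma velocity_comp {f : M → M} {c : ℝ → M} {t : ℝ}
    (hf : MDifferentiableAt 𝓘(ℝ, ℂ) 𝓘(ℝ, ℂ) f (c t))
    (hc : MDifferentiableAt 𝓘(ℝ, ℝ) 𝓘(ℝ, ℂ) c t) :
    velocity (fun s => f (c s)) t = mfderiv 𝓘(ℝ, ℂ) 𝓘(ℝ, ℂ) f (c t) (velocity c t) :=
  mfderiv_comp_apply t hf hc (1 : ℝ)

lemma velocity_comp_chart {f : ℂ → M} {c : ℝ → ℂ} {c' : ℂ} {t : ℝ}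
    (hf : MDifferentiableAt 𝓘(ℝ, ℂ) 𝓘(ℝ, ℂ) f (c t)) (hc : HasDerivAt c c' t) :
    velocity (fun s => f (c s)) t = mfderiv 𝓘(ℝ, ℂ) 𝓘(ℝ, ℂ) f (c t) c' := by
  refine (mfderiv_comp_apply t hf hc.differentiableAt.mdifferentiableAt (1 : ℝ)).trans ?_
  congr 1
  rw [mfderiv_eq_fderiv]
  exact hc.deriv

lemma continuousOn_mk_mfderivWithin [IsManifold 𝓘(ℝ, ℂ) ∞ M] {c : ℝ → M} {s : Set ℝ}
    (hc : ContMDiffOn 𝓘(ℝ, ℝ) 𝓘(ℝ, ℂ) 1 c s) (hs : UniqueDiffOn ℝ s) :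
    ContinuousOn (fun t => (⟨c t, mfderivWithin 𝓘(ℝ, ℝ) 𝓘(ℝ, ℂ) c s t (1 : ℝ)⟩ :
      TangentBundle 𝓘(ℝ, ℂ) M)) s := by
  have : IsManifold 𝓘(ℝ, ℂ) 1 M := IsManifold.of_le (n := ∞) (by simp)
  have h1 := hc.continuousOn_tangentMapWithin le_rfl hs.uniqueMDiffOn
  have h2 : Continuous (fun t : ℝ => (⟨t, (1 : ℝ)⟩ : TangentBundle 𝓘(ℝ, ℝ) ℝ)) :=
    (tangentBundleModelSpaceHomeomorph 𝓘(ℝ, ℝ)).symm.continuous.comp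
      (Continuous.prodMk continuous_id (continuous_const (y := (1 : ℝ))))
  exact h1.comp h2.continuousOn fun t ht => ht

end Curves

section Riemannian

variable {M : Type*} [MetricSpace M] [ChartedSpace ℂ M] [IsManifold 𝓘(ℝ, ℂ) ∞ M]
  [RiemannianBundle (fun x : M => TangentSpace 𝓘(ℝ, ℂ) x)]

instance continuousRiemannianBundle_of_smooth
    [h : IsContMDiffRiemannianBundle 𝓘(ℝ, ℂ) ∞ ℂ (fun x : M => TangentSpace 𝓘(ℝ, ℂ) x)] :
    IsContinuousRiemannianBundle ℂ (fun x : M => TangentSpace 𝓘(ℝ, ℂ) x) := by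
  obtain ⟨g, hg, h⟩ := h.exists_contMDiff
  exact ⟨g, hg.continuous, h⟩

lemma edist_map_le_of_preservesMetric [IsRiemannianManifold 𝓘(ℝ, ℂ) M] {f : M → M}
    (hf : ContMDiff 𝓘(ℝ, ℂ) 𝓘(ℝ, ℂ) ∞ f) (hfm : PreservesMetric f) (x y : M) :
    edist (f x) (f y) ≤ edist x y := by
  rw [IsRiemannianManifold.out (I := 𝓘(ℝ, ℂ)) x y,
    IsRiemannianManifold.out (I := 𝓘(ℝ, ℂ)) (f x) (f y)]
  refine le_of_forall_gt fun r hr => ?_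
  obtain ⟨γ, h0, h1, hγ, hlt⟩ := exists_lt_of_riemannianEDist_lt hr
  refine lt_of_le_of_lt (riemannianEDist_le_pathELength (γ := fun t => f (γ t)) (a := 0) (b := 1)
    ((hf.of_le (by simp)).comp_contMDiffOn hγ) (by rw [h0]) (by rw [h1]) zero_le_one) ?_
  refine lt_of_eq_of_lt ?_ hlt
  rw [pathELength_eq_lintegral_mfderiv_Ioo, pathELength_eq_lintegral_mfderiv_Ioo]
  refine MeasureTheory.setLIntegral_congr_fun measurableSet_Ioo fun t ht => ?_
  have hd : MDifferentiableAt 𝓘(ℝ, ℝ) 𝓘(ℝ, ℂ) γ t :=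
    (hγ.contMDiffAt (Icc_mem_nhds ht.1 ht.2)).mdifferentiableAt one_ne_zero
  have h2 := velocity_comp ((hf.mdifferentiable (by simp)) (γ t)) hd
  have h3 : ‖velocity (fun s => f (γ s)) t‖ = ‖velocity γ t‖ := by rw [h2, hfm]
  have := congrArg ENNReal.ofReal h3
  rwa [ofReal_norm, ofReal_norm] at this

lemma PreservesMetric.symm {f : M ≃ₘ^∞⟮𝓘(ℝ, ℂ), 𝓘(ℝ, ℂ)⟯ M} (hf : PreservesMetric f) :
    PreservesMetric f.symm := by
  intro x v
  rw [← hf (f.symm x)]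
  have h := mfderiv_comp_apply x (f.mdifferentiable (by simp) (f.symm x))
    (f.symm.mdifferentiable (by simp) x) v
  rw [← h]
  have h2 : ∀ g : M → M, g = id → ‖mfderiv 𝓘(ℝ, ℂ) 𝓘(ℝ, ℂ) g x v‖ = ‖v‖ := by
    rintro _ rfl
    rw [mfderiv_id]
    rfl
  exact h2 _ (by ext y; simp)

lemma PreservesMetric.comp {f g : M → M} (hf : ContMDiff 𝓘(ℝ, ℂ) 𝓘(ℝ, ℂ) ∞ f)
    (hg : ContMDiff 𝓘(ℝ, ℂ) 𝓘(ℝ, ℂ) ∞ g) (hfm : PreservesMetric f) (hgm : PreservesMetric g) :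
    PreservesMetric (f ∘ g) := by
  intro x v
  rw [mfderiv_comp_apply x (hf.mdifferentiable (by simp) (g x)) (hg.mdifferentiable (by simp) x),
    hfm, hgm]

lemma dist_map_of_preservesMetric [IsRiemannianManifold 𝓘(ℝ, ℂ) M]
    {f : M ≃ₘ^∞⟮𝓘(ℝ, ℂ), 𝓘(ℝ, ℂ)⟯ M} (hf : PreservesMetric f) (x y : M) :
    dist (f x) (f y) = dist x y := by
  have h : edist (f x) (f y) = edist x y := by
    refine le_antisymm (edist_map_le_of_preservesMetric f.contMDiff hf x y) ?_
    simpa using edist_map_le_of_preservesMetric f.symm.contMDiff hf.symm (f x) (f y)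
  rw [dist_edist, dist_edist, h]

variable [IsContMDiffRiemannianBundle 𝓘(ℝ, ℂ) ∞ ℂ (fun x : M => TangentSpace 𝓘(ℝ, ℂ) x)]

lemma continuousOn_norm_velocity {c : ℝ → M} {J : Set ℝ}
    (hc : ContMDiffOn 𝓘(ℝ, ℝ) 𝓘(ℝ, ℂ) 1 c J) (hJ : IsOpen J) :
    ContinuousOn (fun t => ‖velocity c t‖) J := by
  have h := continuousOn_mk_mfderivWithin hc hJ.uniqueDiffOn
  have h2 := (ContinuousOn.inner_bundle h h).sqrt
  refine h2.congr fun t ht => ?_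
  have h3 : mfderivWithin 𝓘(ℝ, ℝ) 𝓘(ℝ, ℂ) c J t (1 : ℝ) = velocity c t := by
    rw [mfderivWithin_of_isOpen hJ ht]
    rfl
  change ‖velocity c t‖ = √(inner ℝ (mfderivWithin 𝓘(ℝ, ℝ) 𝓘(ℝ, ℂ) c J t (1 : ℝ))
    (mfderivWithin 𝓘(ℝ, ℝ) 𝓘(ℝ, ℂ) c J t (1 : ℝ)))
  rw [h3, ← norm_eq_sqrt_real_inner]

lemma dist_le_of_norm_velocity_le [IsRiemannianManifold 𝓘(ℝ, ℂ) M] {c : ℝ → M} {s t K : ℝ}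
    (hst : s ≤ t) (hc : ContMDiffOn 𝓘(ℝ, ℝ) 𝓘(ℝ, ℂ) 1 c (Icc s t))
    (hK : ∀ r ∈ Icc s t, ‖velocity c r‖ ≤ K) : dist (c s) (c t) ≤ K * (t - s) := by
  have hK0 : 0 ≤ K := (norm_nonneg _).trans (hK s ⟨le_rfl, hst⟩)
  rw [dist_edist]
  refine ENNReal.toReal_le_of_le_ofReal (mul_nonneg hK0 (sub_nonneg.2 hst)) ?_
  rw [IsRiemannianManifold.out (I := 𝓘(ℝ, ℂ)) (c s) (c t)]
  refine (riemannianEDist_le_pathELength hc rfl rfl hst).trans ?_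
  rw [pathELength_eq_lintegral_mfderiv_Icc]
  refine (MeasureTheory.setLIntegral_mono' (g := fun _ => ENNReal.ofReal K) measurableSet_Icc
    fun r hr => ?_).trans ?_
  · rw [← ofReal_norm]
    exact ENNReal.ofReal_le_ofReal (hK r hr)
  · rw [MeasureTheory.setLIntegral_const, Real.volume_Icc, ENNReal.ofReal_mul hK0]

/-- Near `t₀` the speed stays below any `K` exceeding its value there, so `c`, and with it `u ∘ c`,
is `K`-Lipschitz from `t₀`; then `K` decreases to the speed. -/
lemma abs_deriv_comp_le_norm_velocity [IsRiemannianManifold 𝓘(ℝ, ℂ) M] {c : ℝ → M} {J : Set ℝ}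
    (hc : ContMDiffOn 𝓘(ℝ, ℝ) 𝓘(ℝ, ℂ) 1 c J) (hJ : IsOpen J) {t₀ : ℝ} (ht₀ : t₀ ∈ J)
    {u : M → ℝ} (hu : ∀ x y, |u x - u y| ≤ dist x y) {u' : ℝ}
    (hd : HasDerivAt (fun t => u (c t)) u' t₀) : |u'| ≤ ‖velocity c t₀‖ := by
  refine le_of_forall_gt_imp_ge_of_dense fun K hK => ?_
  have hK0 : 0 ≤ K := (norm_nonneg _).trans hK.le
  have hev : ∀ᶠ t in 𝓝 t₀, t ∈ J ∧ ‖velocity c t‖ < K :=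
    (hJ.eventually_mem ht₀).and
      (((continuousOn_norm_velocity hc hJ).continuousAt (hJ.mem_nhds ht₀)).eventually_lt_const hK)
  obtain ⟨δ, hδ, hball⟩ := Metric.eventually_nhds_iff_ball.1 hev
  refine hd.le_of_lip' hK0 (Metric.eventually_nhds_iff_ball.2 ⟨δ, hδ, fun t ht => ?_⟩)
  have key : ∀ a b, a ≤ b → a ∈ Metric.ball t₀ δ → b ∈ Metric.ball t₀ δ →
      dist (c a) (c b) ≤ K * (b - a) := by
    intro a b hab ha hb
    have hsub : Icc a b ⊆ Metric.ball t₀ δ := (convex_ball t₀ δ).ordConnected.out ha hb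
    exact dist_le_of_norm_velocity_le hab (hc.mono fun r hr => (hball r (hsub hr)).1)
      fun r hr => (hball r (hsub hr)).2.le
  rw [Real.norm_eq_abs, Real.norm_eq_abs]
  refine (hu _ _).trans ?_
  rcases le_total t₀ t with h | h
  · rw [dist_comm, abs_of_nonneg (sub_nonneg.2 h)]
    exact key _ _ h (Metric.mem_ball_self hδ) ht
  · rw [abs_sub_comm, abs_of_nonneg (sub_nonneg.2 h)]
    exact key _ _ h ht (Metric.mem_ball_self hδ)

end Riemannian

end

/-! ### Geodesic polar charts and the isometries fixing their centre -/

section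

open Filter Topology Manifold

lemma apply_velocity_congr {M : Type*} [TopologicalSpace M] [ChartedSpace ℂ M] {c d : ℝ → M}
    {s : ℝ} (h : c =ᶠ[𝓝 s] d) (Φ : (x : M) → TangentSpace 𝓘(ℝ, ℂ) x → ℝ) :
    Φ (c s) (velocity c s) = Φ (d s) (velocity d s) := by
  have h1 : mfderiv 𝓘(ℝ, ℝ) 𝓘(ℝ, ℂ) c s = mfderiv 𝓘(ℝ, ℝ) 𝓘(ℝ, ℂ) d s := h.mfderiv_eq
  have h2 : ∀ x y : M, x = y → ∀ v : ℂ, Φ x v = Φ y v := by rintro _ _ rfl _; rfl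
  have h3 : velocity c s = velocity d s := congrArg (fun A : ℝ →L[ℝ] ℂ => A (1 : ℝ)) h1
  rw [h3]
  exact h2 _ _ h.eq_of_nhds _

/-- Strict convexity of the Euclidean ball, by the parallelogram law. -/
lemma eq_of_norm_eq_one_of_two_le_norm_add {V : Type*} [NormedAddCommGroup V]
    [InnerProductSpace ℝ V] {u v : V} (hu : ‖u‖ = 1) (hv : ‖v‖ = 1) (h : 2 ≤ ‖u + v‖) : u = v := by
  have h1 := parallelogram_law_with_norm ℝ u v
  rw [hu, hv] at h1
  have h2 : ‖u - v‖ = 0 := by nlinarith [norm_nonneg (u - v), norm_nonneg (u + v)]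
  exact sub_eq_zero.1 (norm_eq_zero.1 h2)

namespace IsGeodesicPolarChart

variable {M : Type*} [MetricSpace M] [ChartedSpace ℂ M] [IsManifold 𝓘(ℝ, ℂ) ∞ M]
  [RiemannianBundle (fun x : M => TangentSpace 𝓘(ℝ, ℂ) x)]
  {p q : M} {E : OpenPartialHomeomorph M ℂ}

lemma dist_pos (hE : IsGeodesicPolarChart p q E) : 0 < dist p q := _root_.dist_pos.2 hE.ne

lemma mem_source (hE : IsGeodesicPolarChart p q E) {x : M} : x ∈ E.source ↔ x ≠ q := by
  rw [hE.source_eq]; rfl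

lemma mem_target (hE : IsGeodesicPolarChart p q E) {z : ℂ} : z ∈ E.target ↔ ‖z‖ < dist p q := by
  rw [hE.target_eq, mem_ball_zero_iff]

lemma symm_zero (hE : IsGeodesicPolarChart p q E) : E.symm 0 = p := by
  rw [← hE.center, E.left_inv (hE.mem_source.2 hE.ne)]

lemma dist_symm (hE : IsGeodesicPolarChart p q E) {z : ℂ} (hz : ‖z‖ < dist p q) :
    dist p (E.symm z) = ‖z‖ := by
  have h := hE.ray_minimal z.arg ‖z‖ ⟨norm_nonneg z, hz⟩
  rwa [polarPoint, Complex.norm_mul_exp_arg_mul_I] at h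

lemma dist_eq (hE : IsGeodesicPolarChart p q E) {x : M} (hx : x ≠ q) : dist p x = ‖E x‖ := by
  have h := hE.mem_source.2 hx
  rw [← hE.dist_symm (hE.mem_target.1 (E.map_source h)), E.left_inv h]

lemma norm_lt (hE : IsGeodesicPolarChart p q E) {x : M} (hx : x ≠ q) : ‖E x‖ < dist p q :=
  hE.mem_target.1 (E.map_source (hE.mem_source.2 hx))

lemma symm_ne (hE : IsGeodesicPolarChart p q E) {z : ℂ} (hz : ‖z‖ < dist p q) : E.symm z ≠ q :=
  hE.mem_source.1 (E.map_target (hE.mem_target.2 hz))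

lemma contMDiffOn (hE : IsGeodesicPolarChart p q E) :
    ContMDiffOn 𝓘(ℝ, ℂ) 𝓘(ℝ, ℂ) ∞ E {q}ᶜ := by
  rw [← hE.source_eq]
  exact contMDiffOn_of_mem_maximalAtlas hE.smooth

lemma contMDiffOn_symm (hE : IsGeodesicPolarChart p q E) :
    ContMDiffOn 𝓘(ℝ, ℂ) 𝓘(ℝ, ℂ) ∞ E.symm (Metric.ball 0 (dist p q)) := by
  rw [← hE.target_eq]
  exact contMDiffOn_symm_of_mem_maximalAtlas hE.smooth

lemma mdifferentiableAt_symm (hE : IsGeodesicPolarChart p q E) {z : ℂ} (hz : ‖z‖ < dist p q) :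
    MDifferentiableAt 𝓘(ℝ, ℂ) 𝓘(ℝ, ℂ) E.symm z :=
  (hE.contMDiffOn_symm.contMDiffAt
    (Metric.isOpen_ball.mem_nhds (mem_ball_zero_iff.2 hz))).mdifferentiableAt (by simp)

lemma norm_mfderiv_symm_radial (hE : IsGeodesicPolarChart p q E) {s θ : ℝ}
    (hs : s ∈ Ico 0 (dist p q)) :
    ‖mfderiv 𝓘(ℝ, ℂ) 𝓘(ℝ, ℂ) E.symm (s * Complex.exp (θ * Complex.I))
      (Complex.exp (θ * Complex.I))‖ = 1 := by
  have hd : HasDerivAt (fun r : ℝ => (r : ℂ) * Complex.exp (θ * Complex.I))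
      (Complex.exp (θ * Complex.I)) s := by
    simpa using (Complex.ofRealCLM.hasDerivAt (x := s)).mul_const (Complex.exp (θ * Complex.I))
  rw [← hE.ray_unit_speed θ s hs, ← velocity_comp_chart (hE.mdifferentiableAt_symm _) hd]
  · rfl
  · rw [norm_mul, Complex.norm_exp_ofReal_mul_I, mul_one, Complex.norm_real, Real.norm_eq_abs,
      abs_of_nonneg hs.1]
    exact hs.2

/-- Every point other than `q` is strictly closer to `p` than `q` is. -/
lemma map_eq_of_preservesMetric [IsRiemannianManifold 𝓘(ℝ, ℂ) M]
    (hE : IsGeodesicPolarChart p q E) {f : M ≃ₘ^∞⟮𝓘(ℝ, ℂ), 𝓘(ℝ, ℂ)⟯ M}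
    (hf : PreservesMetric f) (hp : f p = p) : f q = q := by
  by_contra h
  have h1 := dist_map_of_preservesMetric hf p q
  rw [hp, hE.dist_eq h] at h1
  exact (hE.norm_lt h).ne h1

variable [IsContMDiffRiemannianBundle 𝓘(ℝ, ℂ) ∞ ℂ (fun x : M => TangentSpace 𝓘(ℝ, ℂ) x)]
  [IsRiemannianManifold 𝓘(ℝ, ℂ) M]

/-- A substitute for the Gauss lemma: along the chart line `z + t b` the distance to `p` is `‖z + t
b‖`, whose derivative cannot exceed the speed. -/
lemma abs_inner_le (hE : IsGeodesicPolarChart p q E) {z : ℂ} (hz : ‖z‖ < dist p q) (hz0 : z ≠ 0)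
    (b : ℂ) : |inner ℝ z b| ≤ ‖z‖ * ‖mfderiv 𝓘(ℝ, ℂ) 𝓘(ℝ, ℂ) E.symm z b‖ := by
  have hzn : 0 < ‖z‖ := norm_pos_iff.2 hz0
  let ℓ : ℝ → ℂ := fun t => z + (t : ℂ) * b
  have hℓ0 : ℓ 0 = z := by simp [ℓ]
  have hℓ : ContDiff ℝ ∞ ℓ := contDiff_const.add (Complex.ofRealCLM.contDiff.mul contDiff_const)
  have hℓd : HasDerivAt ℓ b 0 := by
    simpa [ℓ] using ((Complex.ofRealCLM.hasDerivAt (x := (0 : ℝ))).mul_const b).const_add z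
  let J : Set ℝ := ℓ ⁻¹' Metric.ball 0 (dist p q)
  have hJ : IsOpen J := Metric.isOpen_ball.preimage hℓ.continuous
  have h0 : (0 : ℝ) ∈ J := by simpa [J, hℓ0] using hz
  have hc : ContMDiffOn 𝓘(ℝ, ℝ) 𝓘(ℝ, ℂ) 1 (fun t => E.symm (ℓ t)) J :=
    (hE.contMDiffOn_symm.of_le (by simp)).comp
      (hℓ.contMDiff.of_le (by simp)).contMDiffOn (fun t ht => ht)
  have hsq : HasDerivAt (fun t => ‖ℓ t‖ ^ 2) (2 * inner ℝ (ℓ 0) b) 0 := hℓd.norm_sq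
  have hn : HasDerivAt (fun t => ‖ℓ t‖) (inner ℝ z b / ‖z‖) 0 := by
    have h := hsq.sqrt (by rw [hℓ0]; positivity)
    simp only [hℓ0, Real.sqrt_sq (norm_nonneg _)] at h
    refine h.congr_deriv ?_
    field_simp
  have hd : HasDerivAt (fun t => dist p (E.symm (ℓ t))) (inner ℝ z b / ‖z‖) 0 := by
    refine hn.congr_of_eventuallyEq ?_
    filter_upwards [hJ.mem_nhds h0] with t ht
    exact hE.dist_symm (mem_ball_zero_iff.1 ht)
  have key := abs_deriv_comp_le_norm_velocity hc hJ h0 (u := fun x => dist p x)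
    (fun x y => by simpa [dist_comm] using abs_dist_sub_le x y p) hd
  have hv := velocity_comp_chart (f := E.symm) (t := 0)
    (by rw [hℓ0]; exact hE.mdifferentiableAt_symm hz) hℓd
  rw [hv, abs_div, abs_of_pos hzn, div_le_iff₀ hzn, mul_comm] at key
  have : ∀ w : ℂ, w = z → ‖mfderiv 𝓘(ℝ, ℂ) 𝓘(ℝ, ℂ) E.symm w b‖ =
    ‖mfderiv 𝓘(ℝ, ℂ) 𝓘(ℝ, ℂ) E.symm z b‖ := by rintro _ rfl; rfl
  rwa [this _ hℓ0] at key

lemma mfderiv_symm_injective (hE : IsGeodesicPolarChart p q E) {z : ℂ} (hz : ‖z‖ < dist p q) :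
    Function.Injective (mfderiv 𝓘(ℝ, ℂ) 𝓘(ℝ, ℂ) E.symm z) := by
  have : IsManifold 𝓘(ℝ, ℂ) 1 M := IsManifold.of_le (n := ∞) (by simp)
  have h : E.MDifferentiable 𝓘(ℝ, ℂ) 𝓘(ℝ, ℂ) :=
    ⟨(contMDiffOn_of_mem_maximalAtlas hE.smooth).mdifferentiableOn (by simp),
      (contMDiffOn_symm_of_mem_maximalAtlas hE.smooth).mdifferentiableOn (by simp)⟩
  exact h.symm.mfderiv_injective (hE.mem_target.2 hz)

/-- An isometry carries the unit radial vectors of a geodesic polar chart to such vectors. -/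
lemma deriv_ray_image (hE : IsGeodesicPolarChart p q E) {f : M ≃ₘ^∞⟮𝓘(ℝ, ℂ), 𝓘(ℝ, ℂ)⟯ M}
    (hf : PreservesMetric f) (hp : f p = p) {θ s : ℝ} (hs : s ∈ Ioo 0 (dist p q)) {a : ℂ}
    (ha : HasDerivAt (fun t : ℝ => E (f (polarPoint E t θ))) a s) :
    a = (s : ℂ)⁻¹ * E (f (polarPoint E s θ)) := by
  set w := E (f (polarPoint E s θ)) with hw
  have hmem : ∀ t ∈ Ioo 0 (dist p q), ‖(t : ℂ) * Complex.exp (θ * Complex.I)‖ < dist p q := by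
    intro t ht
    rw [norm_mul, Complex.norm_exp_ofReal_mul_I, mul_one, Complex.norm_real, Real.norm_eq_abs,
      abs_of_pos ht.1]
    exact ht.2
  have hfne : ∀ t ∈ Ioo 0 (dist p q), f (polarPoint E t θ) ≠ q := by
    intro t ht h
    refine hE.symm_ne (hmem t ht) (f.injective ?_)
    exact h.trans (hE.map_eq_of_preservesMetric hf hp).symm
  have hnorm : ∀ t ∈ Ioo 0 (dist p q), ‖E (f (polarPoint E t θ))‖ = t := by
    intro t ht
    have h := dist_map_of_preservesMetric hf p (polarPoint E t θ)
    rwa [hp, hE.dist_eq (hfne t ht), hE.ray_minimal θ t ⟨ht.1.le, ht.2⟩] at h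
  have hws : ‖w‖ = s := hnorm s hs
  have hwL : ‖w‖ < dist p q := hws ▸ hs.2
  have hw0 : w ≠ 0 := norm_pos_iff.1 (hws ▸ hs.1)
  have hnear : ∀ᶠ t in 𝓝 s, t ∈ Ioo 0 (dist p q) := isOpen_Ioo.mem_nhds hs
  have hinner : inner ℝ w a = s := by
    have h1 : HasDerivAt (fun t : ℝ => ‖E (f (polarPoint E t θ))‖ ^ 2) (2 * inner ℝ w a) s :=
      ha.norm_sq
    have h2 : HasDerivAt (fun t : ℝ => t ^ 2) (2 * s) s := by simpa using hasDerivAt_pow 2 s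
    have h3 := h1.unique (h2.congr_of_eventuallyEq
      (hnear.mono fun t ht => by simp only [hnorm t ht]))
    linarith
  have hray : HasDerivAt (fun r : ℝ => (r : ℂ) * Complex.exp (θ * Complex.I))
      (Complex.exp (θ * Complex.I)) s := by
    simpa using (Complex.ofRealCLM.hasDerivAt (x := s)).mul_const (Complex.exp (θ * Complex.I))
  have hpol : MDifferentiableAt 𝓘(ℝ, ℝ) 𝓘(ℝ, ℂ) (fun t : ℝ => polarPoint E t θ) s :=
    MDifferentiableAt.comp s (hE.mdifferentiableAt_symm (hmem s hs))
      hray.differentiableAt.mdifferentiableAt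
  have hanorm : ‖mfderiv 𝓘(ℝ, ℂ) 𝓘(ℝ, ℂ) E.symm w a‖ = 1 := by
    have h1 := velocity_comp_chart (f := E.symm) (hE.mdifferentiableAt_symm hwL) ha
    have h2 := velocity_comp (c := fun t : ℝ => polarPoint E t θ) (f.mdifferentiable (by simp) (polarPoint E s θ)) hpol
    have h3 : (fun t : ℝ => E.symm (E (f (polarPoint E t θ)))) =ᶠ[𝓝 s]
        fun t => f (polarPoint E t θ) :=
      hnear.mono fun t ht => E.left_inv (hE.mem_source.2 (hfne t ht))
    rw [← h1, apply_velocity_congr h3 (fun _ v => ‖v‖), h2, hf]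
    exact hE.ray_unit_speed θ s ⟨hs.1.le, hs.2⟩
  have hwp : (s : ℂ) * Complex.exp (w.arg * Complex.I) = w := by
    rw [← hws, Complex.norm_mul_exp_arg_mul_I]
  set e := Complex.exp (w.arg * Complex.I) with he
  have henorm : ‖mfderiv 𝓘(ℝ, ℂ) 𝓘(ℝ, ℂ) E.symm w e‖ = 1 := by
    have h1 := hE.norm_mfderiv_symm_radial (θ := w.arg) (s := s) ⟨hs.1.le, hs.2⟩
    have h2 : ∀ z : ℂ, z = w → ‖mfderiv 𝓘(ℝ, ℂ) 𝓘(ℝ, ℂ) E.symm z e‖ =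
      ‖mfderiv 𝓘(ℝ, ℂ) 𝓘(ℝ, ℂ) E.symm w e‖ := by rintro _ rfl; rfl
    rwa [← he, h2 _ hwp] at h1
  have hie : inner ℝ w e = s := by
    have h1 : ‖e‖ = 1 := Complex.norm_exp_ofReal_mul_I _
    have h2 : w = s • e := by rw [← hwp, Complex.real_smul]
    rw [h2, real_inner_smul_left, real_inner_self_eq_norm_sq, h1]
    ring
  -- Both `a` and the radial vector `e` have `h`-norm one and radial component one, so the Gauss
  -- inequality forces their sum to have norm at least 2, and strict convexity identifies them.
  have hsum := hE.abs_inner_le hwL hw0 (a + e)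
  rw [inner_add_right, hinner, hie, hws, abs_of_pos (add_pos hs.1 hs.1)] at hsum
  have h2 : 2 ≤ ‖mfderiv 𝓘(ℝ, ℂ) 𝓘(ℝ, ℂ) E.symm w a + mfderiv 𝓘(ℝ, ℂ) 𝓘(ℝ, ℂ) E.symm w e‖ := by
    have h3 := ContinuousLinearMap.map_add (mfderiv 𝓘(ℝ, ℂ) 𝓘(ℝ, ℂ) E.symm w) a e
    rw [← h3]
    refine le_of_mul_le_mul_left (le_of_eq_of_le ?_ hsum) hs.1
    ring
  have h3 := hE.mfderiv_symm_injective hwL (eq_of_norm_eq_one_of_two_le_norm_add hanorm henorm h2)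
  have hs0 : (s : ℂ) ≠ 0 := by exact_mod_cast hs.1.ne'
  have h4 : e = (s : ℂ)⁻¹ * w := by rw [← hwp, inv_mul_cancel_left₀ hs0]
  exact h3.trans h4

/-- In a geodesic polar chart, an isometry that fixes the centre is linear. -/
lemma exists_linear_of_preservesMetric (hE : IsGeodesicPolarChart p q E)
    {f : M ≃ₘ^∞⟮𝓘(ℝ, ℂ), 𝓘(ℝ, ℂ)⟯ M} (hf : PreservesMetric f) (hp : f p = p) :
    ∃ B : ℂ ≃ₗᵢ[ℝ] ℂ, ∀ z : ℂ, ‖z‖ < dist p q → E (f (E.symm z)) = B z := by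
  have hL := hE.dist_pos
  have hfne : ∀ z : ℂ, ‖z‖ < dist p q → f (E.symm z) ≠ q := by
    intro z hz h
    exact hE.symm_ne hz (f.injective (h.trans (hE.map_eq_of_preservesMetric hf hp).symm))
  have hnorm : ∀ z : ℂ, ‖z‖ < dist p q → ‖E (f (E.symm z))‖ = ‖z‖ := by
    intro z hz
    have h := dist_map_of_preservesMetric hf p (E.symm z)
    rwa [hp, hE.dist_eq (hfne z hz), hE.dist_symm hz] at h
  have hA : ContDiffOn ℝ ∞ (fun z => E (f (E.symm z))) (Metric.ball 0 (dist p q)) :=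
    (hE.contMDiffOn.comp (f.contMDiff.comp_contMDiffOn hE.contMDiffOn_symm)
      fun z hz => hfne z (mem_ball_zero_iff.1 hz)).contDiffOn
  have hdiff : ∀ z : ℂ, ‖z‖ < dist p q → DifferentiableAt ℝ (fun z => E (f (E.symm z))) z :=
    fun z hz => (hA.contDiffAt (Metric.isOpen_ball.mem_nhds
      (mem_ball_zero_iff.2 hz))).differentiableAt (by simp)
  have hA0 : E (f (E.symm 0)) = 0 := by rw [hE.symm_zero, hp, hE.center]
  let B := fderiv ℝ (fun z => E (f (E.symm z))) 0
  have hB : ∀ z : ℂ, ‖z‖ < dist p q → E (f (E.symm z)) = B z := by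
    intro z hz
    rcases eq_or_ne z 0 with rfl | hz0
    · rw [hA0, map_zero]
    set e := Complex.exp (z.arg * Complex.I) with he
    have hze : ((‖z‖ : ℝ) : ℂ) * e = z := Complex.norm_mul_exp_arg_mul_I z
    have hene : ‖e‖ = 1 := Complex.norm_exp_ofReal_mul_I _
    have hlt : ∀ t ∈ Ico 0 (dist p q), ‖(t : ℂ) * e‖ < dist p q := by
      intro t ht
      rw [norm_mul, hene, mul_one, Complex.norm_real, Real.norm_eq_abs, abs_of_nonneg ht.1]
      exact ht.2
    let c : ℝ → ℂ := fun t => E (f (E.symm (t * e)))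
    have hc : ∀ t ∈ Ico 0 (dist p q),
        HasDerivAt c (fderiv ℝ (fun z => E (f (E.symm z))) (t * e) e) t := by
      intro t ht
      have h1 : HasDerivAt (fun r : ℝ => (r : ℂ) * e) e t := by
        simpa using (Complex.ofRealCLM.hasDerivAt (x := t)).mul_const e
      exact (hdiff _ (hlt t ht)).hasFDerivAt.comp_hasDerivAt t h1
    -- The image of a ray satisfies `c' = c / t`, so `c / t` is constant; its value is the limit at
    -- `0`, which is `B e`.
    have hquot : ∀ t ∈ Ioo 0 (dist p q), HasDerivAt (fun t : ℝ => t⁻¹ • c t) 0 t := by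
      intro t ht
      have h1 := hc t ⟨ht.1.le, ht.2⟩
      have h2 := hE.deriv_ray_image hf hp ht (θ := z.arg) h1
      have h3 := (hasDerivAt_inv ht.1.ne').smul h1
      refine h3.congr_deriv ?_
      rw [h2]
      have ht0 : (t : ℂ) ≠ 0 := by exact_mod_cast ht.1.ne'
      simp only [Complex.real_smul, c, polarPoint, ← he]
      push_cast
      field_simp
      ring
    have hconst : ∀ t ∈ Ioo 0 (dist p q), t⁻¹ • c t = ‖z‖⁻¹ • c ‖z‖ := fun t ht =>
      isOpen_Ioo.is_const_of_deriv_eq_zero isPreconnected_Ioo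
        (fun t ht => (hquot t ht).differentiableAt.differentiableWithinAt)
        (fun t ht => (hquot t ht).deriv) ht ⟨norm_pos_iff.2 hz0, hz⟩
    have h0 := hc 0 ⟨le_rfl, hL⟩
    rw [hasDerivAt_iff_tendsto_slope_zero] at h0
    have h1 : Tendsto (fun t : ℝ => t⁻¹ • c t) (𝓝[>] 0) (𝓝 (B e)) := by
      refine Tendsto.congr (fun t => ?_) (Tendsto.congr' EventuallyEq.rfl
        (h0.mono_left (nhdsWithin_mono _ fun t (ht : 0 < t) => ht.ne')) |>.trans_eq ?_)
      · simp [c, hA0]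
      · simp [B]
    have h2 : Tendsto (fun t : ℝ => t⁻¹ • c t) (𝓝[>] 0) (𝓝 (‖z‖⁻¹ • c ‖z‖)) := by
      refine tendsto_const_nhds.congr' ?_
      filter_upwards [Ioo_mem_nhdsGT hL] with t ht
      exact (hconst t ht).symm
    have h3 := tendsto_nhds_unique h2 h1
    have h4 : c ‖z‖ = ‖z‖ • B e := by
      rw [← h3, smul_smul, mul_inv_cancel₀ (norm_ne_zero_iff.2 hz0), one_smul]
    rw [← map_smul, Complex.real_smul, hze] at h4
    rw [← h4]
    simp only [c, hze]
  have hBn : ∀ z, ‖B z‖ = ‖z‖ := by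
    intro z
    -- `B` agrees with the isometry on the disc only, so `z` is scaled into it.
    obtain ⟨r, hr, hrz⟩ : ∃ r : ℝ, 0 < r ∧ ‖r • z‖ < dist p q := by
      refine ⟨dist p q / (2 * (‖z‖ + 1)), by positivity, ?_⟩
      rw [norm_smul, Real.norm_eq_abs, abs_of_pos (by positivity), div_mul_eq_mul_div,
        div_lt_iff₀ (by positivity)]
      nlinarith [norm_nonneg z]
    have h := hnorm _ hrz
    rw [hB _ hrz, map_smul, norm_smul, norm_smul] at h
    exact mul_left_cancel₀ (norm_ne_zero_iff.2 hr.ne') h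
  exact ⟨LinearIsometry.toLinearIsometryEquiv ⟨B.toLinearMap, hBn⟩ rfl, fun z hz => hB z hz⟩

end IsGeodesicPolarChart

end

/-! ### The rotations form a smooth family of isometries -/

section

open Filter Topology Manifold

variable {M : Type*} [MetricSpace M] [ChartedSpace ℂ M] [IsManifold 𝓘(ℝ, ℂ) ∞ M]
  [RiemannianBundle (fun x : M => TangentSpace 𝓘(ℝ, ℂ) x)]

/-- The transformation `A` of the plane is the expression in the chart `E` of an isometry of the
surface that fixes `p`. -/
def IsChartIsometry (p q : M) (E : OpenPartialHomeomorph M ℂ) (A : ℂ → ℂ) : Prop :=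
  ∃ f : M ≃ₘ^∞⟮𝓘(ℝ, ℂ), 𝓘(ℝ, ℂ)⟯ M, PreservesMetric f ∧ f p = p ∧
    ∀ z : ℂ, ‖z‖ < dist p q → E (f (E.symm z)) = A z

namespace IsGeodesicPolarChart

variable {p q : M} {E E' : OpenPartialHomeomorph M ℂ}

lemma isChartIsometry_comp [IsRiemannianManifold 𝓘(ℝ, ℂ) M] (hE : IsGeodesicPolarChart p q E)
    {A B : ℂ → ℂ} (hA : IsChartIsometry p q E A) (hB : IsChartIsometry p q E B) :
    IsChartIsometry p q E (A ∘ B) := by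
  obtain ⟨f, hf, hfp, hfA⟩ := hA
  obtain ⟨g, hg, hgp, hgB⟩ := hB
  refine ⟨g.trans f, PreservesMetric.comp (f := f) (g := g) f.contMDiff g.contMDiff hf hg, ?_, fun z hz => ?_⟩
  · change f (g p) = p
    rw [hgp, hfp]
  · have hne : g (E.symm z) ≠ q := fun h =>
      hE.symm_ne hz (g.injective (h.trans (hE.map_eq_of_preservesMetric hg hgp).symm))
    have h1 := hfA _ (hE.norm_lt hne)
    rw [E.left_inv (hE.mem_source.2 hne), hgB z hz] at h1
    exact h1

variable [IsContMDiffRiemannianBundle 𝓘(ℝ, ℂ) ∞ ℂ (fun x : M => TangentSpace 𝓘(ℝ, ℂ) x)]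
  [IsRiemannianManifold 𝓘(ℝ, ℂ) M]

/-- An isometry moving one point of a circle around `p` by the angle `t` is linear and orthogonal in
the chart, hence determined up to a reflection. -/
lemma isChartIsometry_rotation_or_reflection (hE : IsGeodesicPolarChart p q E)
    (hM : IsSphereOfRevolution p) (t : ℝ) :
    IsChartIsometry p q E (fun z => Complex.exp (t * Complex.I) * z) ∨
      IsChartIsometry p q E
        (fun z => Complex.exp (t * Complex.I) * (starRingEnd ℂ) z) := by
  have hL := hE.dist_pos
  set r : ℝ := dist p q / 2 with hr
  have hr0 : (r : ℂ) ≠ 0 := by exact_mod_cast (half_pos hL).ne'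
  have h1 : ‖(r : ℂ)‖ = r := by
    rw [Complex.norm_real, Real.norm_eq_abs, abs_of_pos (half_pos hL)]
  have h2 : ‖Complex.exp (t * Complex.I) * (r : ℂ)‖ = r := by
    rw [norm_mul, Complex.norm_exp_ofReal_mul_I, one_mul, h1]
  have h3 : r < dist p q := half_lt_self hL
  obtain ⟨f, hf, hfp, hf2⟩ := hM.pole (E.symm r) (E.symm (Complex.exp (t * Complex.I) * r)) (by
    rw [hE.dist_symm (h1.trans_lt h3), hE.dist_symm (h2.trans_lt h3), h1, h2])
  obtain ⟨B, hB⟩ := hE.exists_linear_of_preservesMetric hf hfp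
  have h4 : B r = Complex.exp (t * Complex.I) * r := by
    rw [← hB _ (h1.trans_lt h3), hf2, E.right_inv (hE.mem_target.2 (h2.trans_lt h3))]
  obtain ⟨a, rfl | rfl⟩ := linear_isometry_complex B
  · refine Or.inl ⟨f, hf, hfp, fun z hz => ?_⟩
    rw [hB z hz]
    rw [rotation_apply] at h4 ⊢
    rw [mul_right_cancel₀ hr0 h4]
  · refine Or.inr ⟨f, hf, hfp, fun z hz => ?_⟩
    rw [hB z hz]
    simp only [LinearIsometryEquiv.trans_apply, rotation_apply, Complex.conjLIE_apply,
      Complex.conj_ofReal] at h4 ⊢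
    rw [mul_right_cancel₀ hr0 h4]

/-- If only reflections are available for both `t` and `t / 2`, their product is the rotation by `t
/ 2`; in every remaining case but the direct one that rotation is given. Its square is the rotation
by `t`. -/
lemma isChartIsometry_rotation (hE : IsGeodesicPolarChart p q E)
    (hM : IsSphereOfRevolution p) (t : ℝ) :
    IsChartIsometry p q E (fun z => Complex.exp (t * Complex.I) * z) := by
  have hrefl : ∀ a b : ℝ,
      IsChartIsometry p q E (fun z => Complex.exp (a * Complex.I) * (starRingEnd ℂ) z) →
      IsChartIsometry p q E (fun z => Complex.exp (b * Complex.I) * (starRingEnd ℂ) z) →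
      IsChartIsometry p q E (fun z => Complex.exp ((a - b : ℝ) * Complex.I) * z) := by
    intro a b ha hb
    convert hE.isChartIsometry_comp ha hb using 1
    ext z
    simp only [Function.comp_apply, map_mul, Complex.conj_conj, ← Complex.exp_conj,
      Complex.conj_ofReal, Complex.conj_I, ← mul_assoc, ← Complex.exp_add]
    congr 2
    push_cast
    ring
  have hdouble :
      IsChartIsometry p q E (fun z => Complex.exp ((t / 2 : ℝ) * Complex.I) * z) →
      IsChartIsometry p q E (fun z => Complex.exp (t * Complex.I) * z) := by
    intro h
    convert hE.isChartIsometry_comp h h using 1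
    ext z
    simp only [Function.comp_apply, ← mul_assoc, ← Complex.exp_add]
    congr 2
    push_cast
    ring
  rcases hE.isChartIsometry_rotation_or_reflection hM t with h | h
  · exact h
  rcases hE.isChartIsometry_rotation_or_reflection hM (t / 2) with h' | h'
  · exact hdouble h'
  · refine hdouble ?_
    have := hrefl _ _ h h'
    rwa [sub_half] at this

lemma exists_diffeomorph_polarRotation (hE : IsGeodesicPolarChart p q E)
    (hM : IsSphereOfRevolution p) (t : ℝ) :
    ∃ f : M ≃ₘ^∞⟮𝓘(ℝ, ℂ), 𝓘(ℝ, ℂ)⟯ M, PreservesMetric f ∧ f p = p ∧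
      ∀ x, polarRotation E t x = f x := by
  obtain ⟨f, hf, hfp, hfE⟩ := hE.isChartIsometry_rotation hM t
  refine ⟨f, hf, hfp, fun x => ?_⟩
  have hq := hE.map_eq_of_preservesMetric hf hfp
  unfold polarRotation
  split_ifs with hx
  · have hxq := hE.mem_source.1 hx
    have h := hfE _ (hE.norm_lt hxq)
    rw [E.left_inv hx] at h
    have hfx : f x ≠ q := fun h' => hxq (f.injective (h'.trans hq.symm))
    change E.symm (Complex.exp (t * Complex.I) * E x) = f x
    rw [← E.left_inv (hE.mem_source.2 hfx), h]
  · have hxq : x = q := by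
      by_contra h
      exact hx (hE.mem_source.2 h)
    rw [hxq, hq]

lemma polarRotation_of_ne (hE : IsGeodesicPolarChart p q E) {x : M} (hx : x ≠ q) (t : ℝ) :
    polarRotation E t x = E.symm (Complex.exp (t * Complex.I) * E x) := by
  rw [polarRotation, if_pos (hE.mem_source.2 hx)]

lemma polarRotation_right (hE : IsGeodesicPolarChart p q E) (t : ℝ) : polarRotation E t q = q := by
  rw [polarRotation, if_neg (fun h => hE.mem_source.1 h rfl)]

lemma contMDiffOn_polarRotation (hE : IsGeodesicPolarChart p q E) :
    ContMDiffOn (𝓘(ℝ, ℝ).prod 𝓘(ℝ, ℂ)) 𝓘(ℝ, ℂ) ∞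
      (fun z : ℝ × M => polarRotation E z.1 z.2) {z | z.2 ≠ q} := by
  have h1 : ContMDiffOn (𝓘(ℝ, ℝ).prod 𝓘(ℝ, ℂ)) 𝓘(ℝ, ℂ) ∞ (fun z : ℝ × M => E z.2)
      {z | z.2 ≠ q} :=
    hE.contMDiffOn.comp contMDiff_snd.contMDiffOn fun z hz => hz
  have h2 : ContMDiff (𝓘(ℝ, ℝ).prod 𝓘(ℝ, ℂ)) 𝓘(ℝ, ℂ) ∞
      (fun z : ℝ × M => Complex.exp (z.1 * Complex.I)) := by
    have h : ContDiff ℝ ∞ (fun t : ℝ => Complex.exp (t * Complex.I)) :=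
      (Complex.ofRealCLM.contDiff.mul contDiff_const).cexp
    exact h.contMDiff.comp contMDiff_fst
  have h3 : ContMDiffOn (𝓘(ℝ, ℝ).prod 𝓘(ℝ, ℂ)) 𝓘(ℝ, ℂ) ∞
      (fun z : ℝ × M => Complex.exp (z.1 * Complex.I) * E z.2) {z | z.2 ≠ q} := by
    have hm : ContDiff ℝ ∞ (fun w : ℂ × ℂ => w.1 * w.2) := contDiff_mul
    exact hm.contMDiff.comp_contMDiffOn (h2.contMDiffOn.prodMk_space h1)
  refine (hE.contMDiffOn_symm.comp h3 fun z hz => ?_).congr fun z hz =>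
    hE.polarRotation_of_ne hz z.1
  rw [mem_preimage, mem_ball_zero_iff, norm_mul, Complex.norm_exp_ofReal_mul_I, one_mul]
  exact hE.norm_lt hz

lemma contMDiff_polarRotation (hE : IsGeodesicPolarChart p q E)
    (hE' : IsGeodesicPolarChart q p E') (hM : IsSphereOfRevolution p) :
    ContMDiff (𝓘(ℝ, ℝ).prod 𝓘(ℝ, ℂ)) 𝓘(ℝ, ℂ) ∞
      (fun z : ℝ × M => polarRotation E z.1 z.2) := by
  choose f hf hfp hfE using hE.exists_diffeomorph_polarRotation hM
  have hfq : ∀ t, f t q = q := fun t => hE.map_eq_of_preservesMetric (hf t) (hfp t)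
  choose B hB using fun t => hE'.exists_linear_of_preservesMetric (hf t) (hfq t)
  have hL := hE'.dist_pos
  set r : ℝ := dist q p / 2 with hr
  have hr0 : 0 < r := half_pos hL
  -- By linearity `B t w` can be computed at the point `r • w`, away from both poles, where the
  -- formula in the chart `E` is already known to be smooth.
  have hBsmooth : ∀ w : ℂ, ‖w‖ = 1 → ContDiff ℝ ∞ (fun t => B t w) := by
    intro w hw
    have hwr : ‖r • w‖ < dist q p := by
      rw [norm_smul, hw, mul_one, Real.norm_eq_abs, abs_of_pos hr0]
      exact half_lt_self hL
    have hwr0 : r • w ≠ 0 := smul_ne_zero hr0.ne' (norm_pos_iff.1 (hw ▸ one_pos))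
    set y := E'.symm (r • w) with hy
    have hyq : y ≠ q := by
      intro h
      have h1 := hE'.dist_symm hwr
      rw [← hy, h, dist_self] at h1
      exact hwr0 (norm_eq_zero.1 h1.symm)
    have hyp : y ≠ p := hE'.symm_ne hwr
    have h1 : ContMDiff 𝓘(ℝ, ℝ) 𝓘(ℝ, ℂ) ∞ (fun t => polarRotation E t y) := by
      rw [← contMDiffOn_univ]
      exact hE.contMDiffOn_polarRotation.comp
        (contMDiff_id.prodMk contMDiff_const).contMDiffOn fun t _ => hyq
    have h2 : ContMDiff 𝓘(ℝ, ℝ) 𝓘(ℝ, ℂ) ∞ (fun t => E' (polarRotation E t y)) := by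
      rw [← contMDiffOn_univ]
      refine hE'.contMDiffOn.comp h1.contMDiffOn fun t _ h => hyp ?_
      have h' : f t y = p := (hfE t y).symm.trans h
      exact (f t).injective (h'.trans (hfp t).symm)
    have h3 : (fun t => B t w) = fun t => r⁻¹ • E' (polarRotation E t y) := by
      ext1 t
      rw [hfE, hy, hB t _ hwr, map_smul, smul_smul, inv_mul_cancel₀ hr0.ne', one_smul]
    rw [h3]
    exact h2.contDiff.const_smul r⁻¹
  intro z
  by_cases hz : z.2 = q
  · have hopen : IsOpen {z : ℝ × M | z.2 ≠ p} := isOpen_ne.preimage continuous_snd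
    have hzp : z.2 ≠ p := hz ▸ hE.ne.symm
    refine ContMDiffOn.contMDiffAt ?_ (hopen.mem_nhds hzp)
    have h1 : ContMDiffOn (𝓘(ℝ, ℝ).prod 𝓘(ℝ, ℂ)) 𝓘(ℝ, ℂ) ∞ (fun z : ℝ × M => E' z.2)
        {z | z.2 ≠ p} :=
      hE'.contMDiffOn.comp contMDiff_snd.contMDiffOn fun z hz => hz
    -- Expanding in the basis `1`, `I` turns smoothness in `t` of two vectors into joint smoothness.
    have hm : ContDiff ℝ ∞ (fun w : ℝ × ℂ => w.2.re • B w.1 1 + w.2.im • B w.1 Complex.I) :=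
      ((Complex.reCLM.contDiff.comp contDiff_snd).smul
        ((hBsmooth 1 (by simp)).comp contDiff_fst)).add
      ((Complex.imCLM.contDiff.comp contDiff_snd).smul
        ((hBsmooth Complex.I (by simp)).comp contDiff_fst))
    have h2 : ContMDiffOn (𝓘(ℝ, ℝ).prod 𝓘(ℝ, ℂ)) 𝓘(ℝ, ℂ) ∞
        (fun z : ℝ × M => B z.1 (E' z.2)) {z | z.2 ≠ p} := by
      refine (hm.contMDiff.comp_contMDiffOn
        (contMDiff_fst.contMDiffOn.prodMk_space h1)).congr fun z _ => ?_
      simp only [Function.comp_apply, ← map_smul, ← map_add]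
      congr 1
      apply Complex.ext <;> simp
    refine (hE'.contMDiffOn_symm.comp h2 fun z hz => ?_).congr fun z hz => ?_
    · rw [mem_preimage, mem_ball_zero_iff, LinearIsometryEquiv.norm_map]
      exact hE'.norm_lt hz
    · have h3 := hB z.1 _ (hE'.norm_lt hz)
      rw [E'.left_inv (hE'.mem_source.2 hz)] at h3
      have hfz : f z.1 z.2 ≠ p := fun h => hz ((f z.1).injective (h.trans (hfp z.1).symm))
      rw [hfE, Function.comp_apply, ← h3, E'.left_inv (hE'.mem_source.2 hfz)]
  · have hopen : IsOpen {z : ℝ × M | z.2 ≠ q} := isOpen_ne.preimage continuous_snd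
    exact hE.contMDiffOn_polarRotation.contMDiffAt (hopen.mem_nhds hz)

end IsGeodesicPolarChart

end

/-! ### Isometric flows -/

section

open Filter Topology Manifold

variable {M : Type*} [MetricSpace M] [ChartedSpace ℂ M] [IsManifold 𝓘(ℝ, ℂ) ∞ M]
  [RiemannianBundle (fun x : M => TangentSpace 𝓘(ℝ, ℂ) x)]

/-- `ψ` is a smooth one-parameter group of isometries of `M`, with generating field `V`. -/
structure IsIsometricFlow (ψ : ℝ → M → M) (V : (x : M) → TangentSpace 𝓘(ℝ, ℂ) x) : Prop where
  smooth : ContMDiff (𝓘(ℝ, ℝ).prod 𝓘(ℝ, ℂ)) 𝓘(ℝ, ℂ) ∞ (fun z : ℝ × M => ψ z.1 z.2)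
  zero : ∀ x, ψ 0 x = x
  add : ∀ s t x, ψ (s + t) x = ψ s (ψ t x)
  velocity_zero : ∀ x, velocity (fun t => ψ t x) 0 = V x
  preservesMetric : ∀ s, PreservesMetric (ψ s)

namespace IsIsometricFlow

variable {ψ : ℝ → M → M} {V : (x : M) → TangentSpace 𝓘(ℝ, ℂ) x}

lemma contMDiff_left (h : IsIsometricFlow ψ V) (x : M) :
    ContMDiff 𝓘(ℝ, ℝ) 𝓘(ℝ, ℂ) ∞ (fun t => ψ t x) :=
  h.smooth.comp (contMDiff_id.prodMk contMDiff_const)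

lemma contMDiff_right (h : IsIsometricFlow ψ V) (s : ℝ) :
    ContMDiff 𝓘(ℝ, ℂ) 𝓘(ℝ, ℂ) ∞ (ψ s) :=
  h.smooth.comp (contMDiff_const.prodMk contMDiff_id)

lemma velocity_comp_shift {c : ℝ → M} {s t : ℝ}
    (hc : MDifferentiableAt 𝓘(ℝ, ℝ) 𝓘(ℝ, ℂ) c (s + t)) :
    velocity (fun r => c (s + r)) t = velocity c (s + t) := by
  have hd : HasDerivAt (fun r : ℝ => s + r) 1 t := (hasDerivAt_id t).const_add s
  refine (mfderiv_comp_apply t hc hd.differentiableAt.mdifferentiableAt (1 : ℝ)).trans ?_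
  unfold velocity
  congr 1
  rw [mfderiv_eq_fderiv]
  exact hd.deriv

lemma velocity_eq (h : IsIsometricFlow ψ V) (s : ℝ) (x : M) :
    velocity (fun t => ψ t x) s = V (ψ s x) := by
  rw [← h.velocity_zero]
  have h1 : (fun t => ψ t (ψ s x)) = fun t => ψ (s + t) x := by
    ext1 t
    rw [add_comm, h.add]
  have h2 := velocity_comp_shift (c := fun t => ψ t x) (s := s) (t := 0)
    ((h.contMDiff_left x).mdifferentiable (by simp) _)
  -- The tangent spaces at base points that are equal only propositionally are compared inside the
  -- model space `ℂ`.
  have h3 : ∀ c d : ℝ → M, c = d → ((velocity c 0 : ℂ) = velocity d 0) := by rintro _ _ rfl; rfl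
  have h4 : ∀ r : ℝ, r = s →
      ((velocity (fun t => ψ t x) r : ℂ) = velocity (fun t => ψ t x) s) := by rintro _ rfl; rfl
  exact (((h3 _ _ h1).trans h2).trans (h4 _ (add_zero s))).symm

/-- Differentiate `ψ s (ψ t x) = ψ t (ψ s x)` at `t = 0`. -/
lemma mfderiv_field (h : IsIsometricFlow ψ V) (s : ℝ) (x : M) :
    mfderiv 𝓘(ℝ, ℂ) 𝓘(ℝ, ℂ) (ψ s) x (V x) = V (ψ s x) := by
  have h1 := velocity_comp (f := ψ s) (c := fun t => ψ t x) (t := 0)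
    ((h.contMDiff_right s).mdifferentiable (by simp) _)
    ((h.contMDiff_left x).mdifferentiable (by simp) _)
  rw [h.velocity_zero] at h1
  have h2 : (fun t => ψ s (ψ t x)) = fun t => ψ t (ψ s x) := by
    ext1 t
    rw [← h.add, ← h.add, add_comm]
  have h3 : ∀ c d : ℝ → M, c = d → ((velocity c 0 : ℂ) = velocity d 0) := by rintro _ _ rfl; rfl
  have h4 : ∀ y : M, y = x → ((mfderiv 𝓘(ℝ, ℂ) 𝓘(ℝ, ℂ) (ψ s) y (V x) : ℂ) =
      mfderiv 𝓘(ℝ, ℂ) 𝓘(ℝ, ℂ) (ψ s) x (V x)) := by rintro _ rfl; rfl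
  exact (h4 _ (h.zero x)).symm.trans (h1.symm.trans ((h3 _ _ h2).trans (h.velocity_zero _)))

lemma isMIntegralCurve (h : IsIsometricFlow ψ V) (x : M) :
    IsMIntegralCurve (I := 𝓘(ℝ, ℂ)) (fun s => ψ s x) V := by
  intro s
  have h1 := ((h.contMDiff_left x).mdifferentiable (by simp) s).hasMFDerivAt
  have h2 : mfderiv 𝓘(ℝ, ℝ) 𝓘(ℝ, ℂ) (fun s => ψ s x) s =
      (1 : ℝ →L[ℝ] ℝ).smulRight (V (ψ s x)) := by
    ext
    rw [← h.velocity_eq s x]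
    exact (one_smul ℝ (velocity (fun s => ψ s x) s)).symm
  rwa [h2] at h1

/-- The time derivative of the flow contributes `g • V` at the image point; invariance of `V` pulls
it back through the differential, so that an invariant metric sees only `velocity σ t + g • V`. -/
lemma velocity_moved (h : IsIsometricFlow ψ V) {σ : ℝ → M} {T : ℝ → ℝ} {t g : ℝ}
    (hσ : MDifferentiableAt 𝓘(ℝ, ℝ) 𝓘(ℝ, ℂ) σ t) (hT : HasDerivAt T g t) :
    velocity (fun r => ψ (T r) (σ r)) t =
      mfderiv 𝓘(ℝ, ℂ) 𝓘(ℝ, ℂ) (ψ (T t)) (σ t) (velocity σ t + g • V (σ t)) := by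
  have hd : MDifferentiableAt (𝓘(ℝ, ℝ).prod 𝓘(ℝ, ℂ)) 𝓘(ℝ, ℂ) (fun z : ℝ × M => ψ z.1 z.2)
    (T t, σ t) := h.smooth.mdifferentiable (by simp) _
  have hTm := hT.differentiableAt.mdifferentiableAt
  have h1 := mfderiv_comp_apply t hd (hTm.prodMk hσ) (1 : ℝ)
  rw [mfderiv_prodMk hTm hσ] at h1
  have h2 := fun v => mfderiv_prod_eq_add_apply (v := v) hd
  have h3 : mfderiv 𝓘(ℝ, ℝ) 𝓘(ℝ, ℝ) T t (1 : ℝ) = g := by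
    rw [mfderiv_eq_fderiv]
    exact hT.deriv
  have h4 : mfderiv 𝓘(ℝ, ℝ) 𝓘(ℝ, ℂ) (fun r => ψ r (σ t)) (T t) g = g • V (ψ (T t) (σ t)) := by
    rw [← h.velocity_eq]
    refine (congrArg (mfderiv 𝓘(ℝ, ℝ) 𝓘(ℝ, ℂ) (fun r => ψ r (σ t)) (T t)) ?_).trans
      (ContinuousLinearMap.map_smul _ g (1 : ℝ))
    exact (mul_one g).symm
  refine h1.trans ((h2 _).trans ?_)
  rw [ContinuousLinearMap.map_add, ContinuousLinearMap.map_smul, h.mfderiv_field, add_comm, ← h4]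
  congr 1
  exact congrArg _ h3

/-- `V x` is the image of the vector `(1, 0)` at `(0, x)` under the tangent map of the smooth map
`(t, x) ↦ ψ t x`. -/
lemma continuous_field (h : IsIsometricFlow ψ V) :
    Continuous (fun x => (⟨x, V x⟩ : TangentBundle 𝓘(ℝ, ℂ) M)) := by
  have : IsManifold 𝓘(ℝ, ℂ) 1 M := IsManifold.of_le (n := ∞) (by simp)
  have hz : Continuous (fun x => (⟨x, 0⟩ : TangentBundle 𝓘(ℝ, ℂ) M)) :=
    (Bundle.contMDiff_zeroSection (n := 0) (IB := 𝓘(ℝ, ℂ)) ℝ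
      (TangentSpace 𝓘(ℝ, ℂ) : M → Type _)).continuous
  have h1 : Continuous (fun x : M => (equivTangentBundleProd 𝓘(ℝ, ℝ) ℝ 𝓘(ℝ, ℂ) M).symm
      (⟨0, (1 : ℝ)⟩, ⟨x, 0⟩)) :=
    (contMDiff_equivTangentBundleProd_symm (n := 0)).continuous.comp
      (continuous_const.prodMk hz)
  have h2 := (h.smooth.continuous_tangentMap (by simp)).comp h1
  convert h2 using 1
  ext1 x
  have hd : MDifferentiableAt (𝓘(ℝ, ℝ).prod 𝓘(ℝ, ℂ)) 𝓘(ℝ, ℂ) (fun z : ℝ × M => ψ z.1 z.2)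
    (0, x) := h.smooth.mdifferentiable (by simp) _
  have h3 := mfderiv_prod_eq_add_apply (v := ((1 : ℝ), (0 : ℂ))) hd
  have h4 : (mfderiv 𝓘(ℝ, ℂ) 𝓘(ℝ, ℂ) (fun y : M => ψ 0 y) x) (0 : ℂ) = 0 :=
    ContinuousLinearMap.map_zero _
  have h5 : mfderiv (𝓘(ℝ, ℝ).prod 𝓘(ℝ, ℂ)) 𝓘(ℝ, ℂ) (fun z : ℝ × M => ψ z.1 z.2) (0, x)
      ((1 : ℝ), (0 : ℂ)) = V x :=
    h3.trans ((congrArg₂ (fun a b : ℂ => a + b) (h.velocity_zero x) h4).trans (add_zero _))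
  have h6 : ∀ y : M, y = x → ∀ v : ℂ, v = V x →
      (⟨x, V x⟩ : TangentBundle 𝓘(ℝ, ℂ) M) = ⟨y, v⟩ := by rintro _ rfl _ rfl; rfl
  exact h6 _ (h.zero x) _ h5

end IsIsometricFlow

/-- Any speed `ν` is allowed, so that the reversed flow is covered by `-μ`. -/
lemma isIsometricFlow_polarRotation
    [IsContMDiffRiemannianBundle 𝓘(ℝ, ℂ) ∞ ℂ (fun x : M => TangentSpace 𝓘(ℝ, ℂ) x)]
    [IsRiemannianManifold 𝓘(ℝ, ℂ) M] {p q : M} {E E' : OpenPartialHomeomorph M ℂ}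
    (hM : IsSphereOfRevolution p) (hE : IsGeodesicPolarChart p q E)
    (hE' : IsGeodesicPolarChart q p E') (ν : ℝ) :
    IsIsometricFlow (fun s x => polarRotation E (ν * s) x) (fun x => ν • angularField E x) where
  smooth := by
    have h1 : ContMDiff (𝓘(ℝ, ℝ).prod 𝓘(ℝ, ℂ)) 𝓘(ℝ, ℝ) ∞ (fun z : ℝ × M => ν * z.1) :=
      (contDiff_const.mul contDiff_id).contMDiff.comp contMDiff_fst
    exact (hE.contMDiff_polarRotation hE' hM).comp (h1.prodMk contMDiff_snd)
  zero x := by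
    by_cases hx : x = q
    · rw [hx, hE.polarRotation_right]
    · simp [hE.polarRotation_of_ne hx, E.left_inv (hE.mem_source.2 hx)]
  add s t x := by
    by_cases hx : x = q
    · rw [hx, hE.polarRotation_right, hE.polarRotation_right, hE.polarRotation_right]
    · have h1 : ‖Complex.exp ((ν * t : ℝ) * Complex.I) * E x‖ < dist p q := by
        rw [norm_mul, Complex.norm_exp_ofReal_mul_I, one_mul]
        exact hE.norm_lt hx
      rw [hE.polarRotation_of_ne hx, hE.polarRotation_of_ne hx,
        hE.polarRotation_of_ne (hE.symm_ne h1), E.right_inv (hE.mem_target.2 h1), ← mul_assoc,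
        ← Complex.exp_add]
      congr 3
      push_cast
      ring
  velocity_zero x := by
    have h1 : MDifferentiableAt 𝓘(ℝ, ℝ) 𝓘(ℝ, ℂ) (fun t => polarRotation E t x) (ν * 0) :=
      ((hE.contMDiff_polarRotation hE' hM).comp
        (contMDiff_id.prodMk contMDiff_const)).mdifferentiable (by simp) _
    have hd : HasDerivAt (fun r : ℝ => ν * r) ν 0 := by simpa using (hasDerivAt_id 0).const_mul ν
    have h2 := mfderiv_comp_apply 0 h1 hd.differentiableAt.mdifferentiableAt (1 : ℝ)
    have h3 : mfderiv 𝓘(ℝ, ℝ) 𝓘(ℝ, ℝ) (fun r : ℝ => ν * r) 0 (1 : ℝ) = ν • (1 : ℝ) := by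
      rw [mfderiv_eq_fderiv, smul_eq_mul, mul_one]
      exact hd.deriv
    rw [h3] at h2
    have h4 : ∀ r : ℝ, r = 0 →
        ((mfderiv 𝓘(ℝ, ℝ) 𝓘(ℝ, ℂ) (fun t => polarRotation E t x) r (ν • (1 : ℝ)) : ℂ) =
          ν • (angularField E x : ℂ)) := by
      rintro _ rfl
      exact ContinuousLinearMap.map_smul _ ν (1 : ℝ)
    exact h2.trans (h4 _ (mul_zero ν))
  preservesMetric s := by
    obtain ⟨f, hf, -, hfE⟩ := hE.exists_diffeomorph_polarRotation hM (ν * s)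
    have h1 : polarRotation E (ν * s) = f := funext hfE
    change PreservesMetric (polarRotation E (ν * s))
    rwa [h1]

end

/-! ### Smooth clocks, and the transfer of geodesics by navigation -/

section

open Filter Topology Manifold MeasureTheory

section Approximation

/-- Density of continuous functions in `L¹`, followed by Weierstrass approximation on `[c, d]`. -/
lemma exists_contDiff_integral_abs_sub_le {f : ℝ → ℝ} {c d : ℝ} (hcd : c < d)
    (hf : IntervalIntegrable f volume c d) {ε : ℝ} (hε : 0 < ε) :
    ∃ g : ℝ → ℝ, ContDiff ℝ ∞ g ∧ ∫ t in c..d, |f t - g t| ≤ ε := by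
  have hf' : Integrable f (volume.restrict (Ioc c d)) :=
    (intervalIntegrable_iff_integrableOn_Ioc_of_le hcd.le).1 hf
  obtain ⟨k, -, hk, hkc, -⟩ := hf'.exists_hasCompactSupport_integral_sub_le (half_pos hε)
  have hdc : 0 < d - c := sub_pos.2 hcd
  obtain ⟨P, hP⟩ := exists_polynomial_near_of_continuousOn c d k hkc.continuousOn
    (ε / (2 * (d - c))) (by positivity)
  refine ⟨fun t => P.eval t, by simpa using P.contDiff_aeval (𝕜 := ℝ) ∞, ?_⟩
  have hk' : ∫ t in c..d, |f t - k t| ≤ ε / 2 := by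
    rw [intervalIntegral.integral_of_le hcd.le]
    exact hk
  have hki : IntervalIntegrable k volume c d := hkc.intervalIntegrable _ _
  have hPi : IntervalIntegrable (fun t => P.eval t) volume c d :=
    P.continuous.intervalIntegrable _ _
  have hi1 : IntervalIntegrable (fun t => |f t - k t|) volume c d := (hf.sub hki).abs
  calc ∫ t in c..d, |f t - P.eval t|
      ≤ ∫ t in c..d, (|f t - k t| + ε / (2 * (d - c))) := by
        refine intervalIntegral.integral_mono_on hcd.le (hf.sub hPi).abs
          (hi1.add intervalIntegrable_const) fun t ht => ?_
        have h1 := hP t ht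
        rw [abs_sub_comm] at h1
        calc |f t - P.eval t| = |(f t - k t) + (k t - P.eval t)| := by ring_nf
          _ ≤ |f t - k t| + |k t - P.eval t| := abs_add_le _ _
          _ ≤ _ := by linarith
    _ = (∫ t in c..d, |f t - k t|) + ε / 2 := by
        rw [intervalIntegral.integral_add hi1 intervalIntegrable_const,
          intervalIntegral.integral_const, smul_eq_mul]
        congr 1
        field_simp
    _ ≤ ε := by linarith

/-- An integrable function of integral less than `ℓ` differs in mean arbitrarily little from a
smooth function which, increased by a nonnegative constant, has integral `ℓ`. -/
lemma exists_primitive {f : ℝ → ℝ} {a b c d : ℝ} (hcd : c < d)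
    (hf : IntervalIntegrable f volume c d) (hlt : ∫ t in c..d, f t < b - a)
    {C w : ℝ} (hC : 0 ≤ C) (hw0 : 0 ≤ w) (hw : w < 1) :
    ∃ (g T : ℝ → ℝ) (κ : ℝ), 0 ≤ κ ∧ Continuous g ∧ ContDiff ℝ ∞ T ∧ T c = a ∧ T d = b ∧
      (∀ t, HasDerivAt T (g t + κ) t) ∧
      ∫ t in c..d, (f t + C * |g t - f t| + w * κ) < b - a := by
  set δ := b - a - ∫ t in c..d, f t with hδ
  have hδ0 : 0 < δ := sub_pos.2 hlt
  have hdc : 0 < d - c := sub_pos.2 hcd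
  have h1w : 0 < 1 - w := sub_pos.2 hw
  -- The final integral is at most `(b - a) - (1 - w) * δ + (C + w) * ε`, and this `ε` makes the
  -- last term at most half of the gain `(1 - w) * δ`.
  set ε := (1 - w) * δ / (2 * (C + 1)) with hε
  have hC1 : 0 < C + 1 := by linarith
  have hε0 : 0 < ε := by positivity
  have hεC : ε * (2 * (C + 1)) = (1 - w) * δ := by
    rw [hε]
    field_simp
  obtain ⟨g, hg, hfg⟩ := exists_contDiff_integral_abs_sub_le hcd hf hε0
  have hgi : IntervalIntegrable g volume c d := hg.continuous.intervalIntegrable _ _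
  have hdiff : |(∫ t in c..d, f t) - ∫ t in c..d, g t| ≤ ε := by
    rw [← intervalIntegral.integral_sub hf hgi]
    exact (intervalIntegral.abs_integral_le_integral_abs hcd.le).trans hfg
  obtain ⟨hd1, hd2⟩ := abs_le.1 hdiff
  -- The time left over is spread evenly; it is nonnegative because `ε ≤ δ`.
  set κ := (b - a - ∫ t in c..d, g t) / (d - c) with hκ
  have hκe : κ * (d - c) = b - a - ∫ t in c..d, g t := by
    rw [hκ]
    field_simp
  have hεδ : ε ≤ δ := by nlinarith
  have hκ0 : 0 ≤ κ := div_nonneg (by linarith) hdc.le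
  have hT : ∀ t, HasDerivAt (fun t => a + (∫ s in c..t, g s) + κ * (t - c)) (g t + κ) t := by
    intro t
    have h1 : HasDerivAt (fun t => ∫ s in c..t, g s) (g t) t :=
      hg.continuous.integral_hasStrictDerivAt c t |>.hasDerivAt
    have h2 : HasDerivAt (fun t : ℝ => κ * (t - c)) κ t := by
      simpa using ((hasDerivAt_id t).sub_const c).const_mul κ
    exact (h1.const_add a).add h2
  refine ⟨g, fun t => a + (∫ s in c..t, g s) + κ * (t - c), κ, hκ0, hg.continuous, ?_, by simp, ?_,
    hT, ?_⟩
  · rw [contDiff_infty_iff_deriv]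
    refine ⟨fun t => (hT t).differentiableAt, ?_⟩
    rw [funext fun t => (hT t).deriv]
    exact hg.add contDiff_const
  · simp only [hκe]
    ring
  · have hi : IntervalIntegrable (fun t => C * |g t - f t|) volume c d :=
      (hgi.sub hf).abs.const_mul C
    rw [intervalIntegral.integral_add (hf.add hi) intervalIntegrable_const,
      intervalIntegral.integral_add hf hi, intervalIntegral.integral_const_mul,
      intervalIntegral.integral_const, smul_eq_mul]
    have h3 : ∫ t in c..d, |g t - f t| ≤ ε := by simpa only [abs_sub_comm] using hfg
    have h4 : (d - c) * (w * κ) = w * (b - a - ∫ t in c..d, g t) := by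
      rw [← hκe]
      ring
    rw [h4]
    have h5 := mul_le_mul_of_nonneg_left h3 hC
    have h6 : w * (b - a - ∫ t in c..d, g t) ≤ w * (δ + ε) :=
      mul_le_mul_of_nonneg_left (by linarith) hw0
    nlinarith

end Approximation

section Piecewise

variable {M : Type*} [TopologicalSpace M] [ChartedSpace ℂ M]

lemma exists_mem_Ioo_of_notMem_range {n : ℕ} {τ : ℕ → ℝ} {t : ℝ} (h0 : τ 0 < t) (hn : t < τ n)
    (ht : ∀ i, t ≠ τ i) : ∃ i < n, t ∈ Ioo (τ i) (τ (i + 1)) := by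
  induction n with
  | zero => exact absurd hn h0.not_gt
  | succ n ih =>
    rcases lt_or_gt_of_ne (ht n) with h | h
    · obtain ⟨i, hi, hti⟩ := ih h
      exact ⟨i, hi.trans n.lt_succ_self, hti⟩
    · exact ⟨n, n.lt_succ_self, h, hn⟩

lemma IsPiecewiseSmooth.ae_mdifferentiableAt {σ : ℝ → M} {c d : ℝ}
    (hσ : IsPiecewiseSmooth σ c d) :
    ∀ᵐ t, t ∈ Ioc c d → MDifferentiableAt 𝓘(ℝ, ℝ) 𝓘(ℝ, ℂ) σ t := by
  obtain ⟨n, τ, -, rfl, rfl, hs⟩ := hσ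
  have hc : (range τ).Countable := countable_range τ
  filter_upwards [hc.ae_notMem volume] with t ht htI
  have hne : ∀ i, t ≠ τ i := fun i h => ht ⟨i, h.symm⟩
  obtain ⟨i, hi, hti⟩ := exists_mem_Ioo_of_notMem_range htI.1 (lt_of_le_of_ne htI.2 (hne n)) hne
  exact ((hs i hi).contMDiffAt (Icc_mem_nhds hti.1 hti.2)).mdifferentiableAt (by simp)

/-- On each closed piece the one-sided derivative is continuous, and it differs from `velocity` at
most at the end points. -/
lemma IsPiecewiseSmooth.intervalIntegrable [IsManifold 𝓘(ℝ, ℂ) ∞ M] {σ : ℝ → M} {c d : ℝ}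
    (hσ : IsPiecewiseSmooth σ c d) {Φ : (x : M) → TangentSpace 𝓘(ℝ, ℂ) x → ℝ}
    (hΦ : Continuous fun v : TangentBundle 𝓘(ℝ, ℂ) M => Φ v.1 v.2) :
    IntervalIntegrable (fun t => Φ (σ t) (velocity σ t)) volume c d := by
  obtain ⟨n, τ, hτ, rfl, rfl, hs⟩ := hσ
  refine IntervalIntegrable.trans_iterate fun i hi => ?_
  rcases (hτ i.le_succ).eq_or_lt with h | h
  · rw [show i + 1 = i.succ from rfl, ← h]
  have h1 := continuousOn_mk_mfderivWithin ((hs i hi).of_le (by simp)) (uniqueDiffOn_Icc h)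
  have h2 := (hΦ.comp_continuousOn h1).intervalIntegrable_of_Icc (μ := volume) h.le
  rw [intervalIntegrable_iff_integrableOn_Ioo_of_le h.le] at h2 ⊢
  refine h2.congr_fun (fun t ht => ?_) measurableSet_Ioo
  have h3 : mfderivWithin 𝓘(ℝ, ℝ) 𝓘(ℝ, ℂ) σ (Icc (τ i) (τ (i + 1))) t =
      mfderiv 𝓘(ℝ, ℝ) 𝓘(ℝ, ℂ) σ t := mfderivWithin_of_mem_nhds (Icc_mem_nhds ht.1 ht.2)
  exact congrArg (fun A : ℝ →L[ℝ] ℂ => Φ (σ t) (A (1 : ℝ))) h3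

end Piecewise

section Transfer

variable {M : Type*} [MetricSpace M] [ChartedSpace ℂ M] [IsManifold 𝓘(ℝ, ℂ) ∞ M]
  [RiemannianBundle (fun x : M => TangentSpace 𝓘(ℝ, ℂ) x)]

/-- A continuous function on the tangent bundle that is invariant under the flow `ψ`. -/
structure IsInvariantUnder (ψ : ℝ → M → M) (Φ : (x : M) → TangentSpace 𝓘(ℝ, ℂ) x → ℝ) :
    Prop where
  continuous : Continuous fun v : TangentBundle 𝓘(ℝ, ℂ) M => Φ v.1 v.2
  invariant : ∀ s x v, Φ (ψ s x) (mfderiv 𝓘(ℝ, ℂ) 𝓘(ℝ, ℂ) (ψ s) x v) = Φ x v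

/-- The metric `Φ₂` is obtained from `Φ₁` by navigation with the wind `V`: travelling with the
wind, for the time needed to follow a vector without it, one follows the sum; and the wind can be
used for moving faster or slower than that. -/
structure IsNavigation (Φ₁ Φ₂ : (x : M) → TangentSpace 𝓘(ℝ, ℂ) x → ℝ)
    (V : (x : M) → TangentSpace 𝓘(ℝ, ℂ) x) : Prop where
  unit : ∀ x v, Φ₁ x v = 1 → Φ₂ x (v + V x) = 1
  le : ∃ C w : ℝ, 0 ≤ C ∧ 0 ≤ w ∧ w < 1 ∧ ∀ x v e κ, 0 ≤ κ →
    Φ₂ x (v + (Φ₁ x v + e + κ) • V x) ≤ Φ₁ x v + C * |e| + w * κ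

variable {ψ : ℝ → M → M} {V : (x : M) → TangentSpace 𝓘(ℝ, ℂ) x}
  {Φ₁ Φ₂ : (x : M) → TangentSpace 𝓘(ℝ, ℂ) x → ℝ}

lemma IsPiecewiseSmooth.moved (hψ : IsIsometricFlow ψ V) {σ : ℝ → M} {T : ℝ → ℝ} {c d : ℝ}
    (hσ : IsPiecewiseSmooth σ c d) (hT : ContDiff ℝ ∞ T) :
    IsPiecewiseSmooth (fun t => ψ (T t) (σ t)) c d := by
  obtain ⟨n, τ, hτ, h0, hn, hs⟩ := hσ
  exact ⟨n, τ, hτ, h0, hn, fun i hi =>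
    hψ.smooth.comp_contMDiffOn (hT.contMDiff.contMDiffOn.prodMk (hs i hi))⟩

/-- The curve is `t ↦ ψ (T t) (σ t)` for the clock `T` of `exists_primitive`; the integrand there is
exactly the bound that `IsNavigation.le` gives for its `Φ₂`-speed. -/
lemma IsNavigation.exists_moved_curve (hN : IsNavigation Φ₁ Φ₂ V) (hψ : IsIsometricFlow ψ V)
    (h₁ : IsInvariantUnder ψ Φ₁) (h₂ : IsInvariantUnder ψ Φ₂) {σ : ℝ → M} {a b c d : ℝ}
    (hcd : c < d) (hσ : IsPiecewiseSmooth σ c d) (hlt : curveLength Φ₁ σ c d < b - a) :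
    ∃ η : ℝ → M, IsPiecewiseSmooth η c d ∧ η c = ψ a (σ c) ∧ η d = ψ b (σ d) ∧
      curveLength Φ₂ η c d < b - a := by
  obtain ⟨C, w, hC, hw0, hw, hle⟩ := hN.le
  have hf := hσ.intervalIntegrable h₁.continuous
  obtain ⟨g, T, κ, hκ, hgc, hT, hTc, hTd, hTd', hint⟩ := exists_primitive hcd hf hlt hC hw0 hw
  have hη := hσ.moved hψ hT
  refine ⟨_, hη, by simp only [hTc], by simp only [hTd], lt_of_le_of_lt ?_ hint⟩
  have hgi : IntervalIntegrable g volume c d := hgc.intervalIntegrable _ _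
  refine intervalIntegral.integral_mono_ae_restrict hcd.le (hη.intervalIntegrable h₂.continuous)
    ((hf.add ((hgi.sub hf).abs.const_mul C)).add intervalIntegrable_const) ?_
  rw [EventuallyLE, ae_restrict_iff' measurableSet_Icc]
  have hc : ∀ᵐ t : ℝ, t ≠ c := by simp [ae_iff]
  filter_upwards [hσ.ae_mdifferentiableAt, hc] with t ht htc htI
  have htd := ht ⟨lt_of_le_of_ne htI.1 htc.symm, htI.2⟩
  rw [hψ.velocity_moved htd (hTd' t), h₂.invariant]
  -- The error `e` is chosen so that `Φ₁ + e + κ` is the clock rate `g + κ`.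
  have h := hle (σ t) (velocity σ t) (g t - Φ₁ (σ t) (velocity σ t)) κ hκ
  rwa [add_sub_cancel] at h

/-- Unit-speed geodesics are carried to unit-speed geodesics by navigation. -/
lemma IsUnitSpeedGeodesic.moved (hN : IsNavigation Φ₁ Φ₂ V) (hψ : IsIsometricFlow ψ V)
    (hN' : IsNavigation Φ₂ Φ₁ (fun x => -V x))
    (hψ' : IsIsometricFlow (fun s => ψ (-s)) (fun x => -V x))
    (h₁ : IsInvariantUnder ψ Φ₁) (h₂ : IsInvariantUnder ψ Φ₂) {α β : ℝ → M} {J : Set ℝ}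
    (hJ : IsOpen J) (hJc : J.OrdConnected)
    (hα : IsUnitSpeedGeodesic Φ₁ α J) (hβ : ∀ s ∈ J, β s = ψ s (α s)) :
    IsUnitSpeedGeodesic Φ₂ β J := by
  have hsmooth : ContMDiffOn 𝓘(ℝ, ℝ) 𝓘(ℝ, ℂ) ∞ β J :=
    (hψ.smooth.comp_contMDiffOn (contMDiffOn_id.prodMk hα.smooth)).congr hβ
  have hunit : ∀ s ∈ J, Φ₂ (β s) (velocity β s) = 1 := by
    intro s hs
    have h1 : β =ᶠ[𝓝 s] fun s => ψ (id s) (α s) := (hJ.eventually_mem hs).mono hβ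
    have h2 : MDifferentiableAt 𝓘(ℝ, ℝ) 𝓘(ℝ, ℂ) α s :=
      (hα.smooth.contMDiffAt (hJ.mem_nhds hs)).mdifferentiableAt (by simp)
    rw [apply_velocity_congr h1 Φ₂, hψ.velocity_moved h2 (hasDerivAt_id s), h₂.invariant, one_smul]
    exact hN.unit _ _ (hα.unit_speed s hs)
  have hlen : ∀ (Φ : (x : M) → TangentSpace 𝓘(ℝ, ℂ) x → ℝ) (c : ℝ → M),
      (∀ s ∈ J, Φ (c s) (velocity c s) = 1) → ∀ s₁ ∈ J, ∀ s₂ ∈ J, s₁ < s₂ →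
      curveLength Φ c s₁ s₂ = s₂ - s₁ := by
    intro Φ c hc s₁ hs₁ s₂ hs₂ hlt
    have h : EqOn (fun t => Φ (c t) (velocity c t)) (fun _ => (1 : ℝ)) (uIcc s₁ s₂) := by
      intro t ht
      rw [uIcc_of_le hlt.le] at ht
      exact hc t (hJc.out hs₁ hs₂ ht)
    rw [curveLength, intervalIntegral.integral_congr h]
    simp
  have hinv : ∀ {Φ : (x : M) → TangentSpace 𝓘(ℝ, ℂ) x → ℝ}, IsInvariantUnder ψ Φ →
      IsInvariantUnder (fun s => ψ (-s)) Φ := fun h => ⟨h.continuous, fun s => h.invariant (-s)⟩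
  refine ⟨hsmooth, hunit, fun s₀ hs₀ => ?_⟩
  obtain ⟨δ, hδ, hmin⟩ := hα.locally_minimizing s₀ hs₀
  refine ⟨δ, hδ, fun s₁ hs₁ s₂ hs₂ h01 h12 h20 σ c d hcd hσ hσc hσd => ?_⟩
  rw [hlen Φ₂ β hunit s₁ hs₁ s₂ hs₂ h12]
  -- A competitor shorter than the elapsed time `s₂ - s₁` would be carried back, against the wind,
  -- to one that beats `α`.
  by_contra! hlt
  obtain ⟨η, hη, hηc, hηd, hηlt⟩ :=
    hN'.exists_moved_curve hψ' (hinv h₂) (hinv h₁) hcd hσ hlt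
  have hback : ∀ s ∈ J, ψ (-s) (β s) = α s := by
    intro s hs
    rw [hβ s hs, ← hψ.add, neg_add_cancel, hψ.zero]
  have h := hmin s₁ hs₁ s₂ hs₂ h01 h12 h20 η c d hcd hη
    (by rw [hηc, hσc, hback s₁ hs₁]) (by rw [hηd, hσd, hback s₂ hs₂])
  rw [hlen Φ₁ α hα.unit_speed s₁ hs₁ s₂ hs₂ h12] at h
  exact absurd hηlt h.not_gt

end Transfer

end

/-! ### The Randers metric as a navigation metric -/

section

open Filter Topology Manifold MeasureTheory

section Randers

variable {M : Type*} [MetricSpace M] [ChartedSpace ℂ M]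
  [RiemannianBundle (fun x : M => TangentSpace 𝓘(ℝ, ℂ) x)]
  {W : (x : M) → TangentSpace 𝓘(ℝ, ℂ) x} {x : M}

lemma randersMetric_nonneg (hW : ‖W x‖ < 1) (v : TangentSpace 𝓘(ℝ, ℂ) x) :
    0 ≤ randersMetric W x v := by
  have hlam : 0 < 1 - ‖W x‖ ^ 2 := by nlinarith [norm_nonneg (W x)]
  refine div_nonneg (sub_nonneg.2 (Real.le_sqrt_of_sq_le ?_)) hlam.le
  nlinarith [mul_nonneg hlam.le (sq_nonneg ‖v‖)]

/-- Squared, this is the quadratic equation `lam F² + 2 ⟨W, v⟩ F = ‖v‖²`, of which the Randers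
formula is the nonnegative root. -/
lemma norm_sub_randersMetric_smul (hW : ‖W x‖ < 1) (v : TangentSpace 𝓘(ℝ, ℂ) x) :
    ‖v - randersMetric W x v • W x‖ = randersMetric W x v := by
  have hlam : 0 < 1 - ‖W x‖ ^ 2 := by nlinarith [norm_nonneg (W x)]
  have h0 := randersMetric_nonneg hW v
  set F := randersMetric W x v with hF
  set b := inner ℝ (W x) v with hb
  have h1 : (1 - ‖W x‖ ^ 2) * F + b = √((1 - ‖W x‖ ^ 2) * ‖v‖ ^ 2 + b ^ 2) := by
    rw [hF, randersMetric, ← hb, mul_div_cancel₀ _ hlam.ne']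
    ring
  have h2 : ((1 - ‖W x‖ ^ 2) * F + b) ^ 2 = (1 - ‖W x‖ ^ 2) * ‖v‖ ^ 2 + b ^ 2 := by
    rw [h1, Real.sq_sqrt]
    positivity
  have h3 : (1 - ‖W x‖ ^ 2) * F ^ 2 + 2 * b * F = ‖v‖ ^ 2 := by
    refine mul_left_cancel₀ hlam.ne' ?_
    linarith
  have h4 : ‖v - F • W x‖ ^ 2 = F ^ 2 := by
    rw [norm_sub_sq_real, norm_smul, real_inner_smul_right, real_inner_comm, ← hb,
      Real.norm_eq_abs, mul_pow, sq_abs]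
    linarith
  exact (sq_eq_sq₀ (norm_nonneg _) h0).1 h4

lemma norm_sub_smul_le {V : Type*} [NormedAddCommGroup V] [NormedSpace ℝ V] (v w : V) (s t : ℝ) :
    ‖v - s • w‖ ≤ ‖v - t • w‖ + |s - t| * ‖w‖ := by
  have h : v - s • w = (v - t • w) - (s - t) • w := by
    rw [sub_smul]
    abel
  rw [h, ← Real.norm_eq_abs, ← norm_smul]
  exact norm_sub_le _ _

/-- Since `‖W x‖ < 1`, the function `f - ‖v - f • W x‖` is strictly increasing in `f`, and it
vanishes at the Randers norm. -/
lemma randersMetric_le (hW : ‖W x‖ < 1) {v : TangentSpace 𝓘(ℝ, ℂ) x} {f : ℝ}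
    (h : ‖v - f • W x‖ ≤ f) : randersMetric W x v ≤ f := by
  by_contra! hlt
  have h1 := norm_sub_randersMetric_smul hW v
  have h2 := norm_sub_smul_le v (W x) (randersMetric W x v) f
  rw [h1, abs_of_pos (sub_pos.2 hlt)] at h2
  nlinarith [sub_pos.2 hlt]

lemma randersMetric_eq_iff (hW : ‖W x‖ < 1) {v : TangentSpace 𝓘(ℝ, ℂ) x} {f : ℝ} :
    randersMetric W x v = f ↔ ‖v - f • W x‖ = f := by
  refine ⟨fun h => h ▸ norm_sub_randersMetric_smul hW v, fun h => ?_⟩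
  refine le_antisymm (randersMetric_le hW h.le) ?_
  by_contra! hlt
  have h2 := norm_sub_smul_le v (W x) f (randersMetric W x v)
  rw [h, norm_sub_randersMetric_smul hW, abs_of_pos (sub_pos.2 hlt)] at h2
  nlinarith [sub_pos.2 hlt]

lemma isNavigation_randersMetric {w : ℝ} (hw0 : 0 ≤ w) (hw : w < 1) (hW : ∀ x, ‖W x‖ ≤ w) :
    IsNavigation riemannianNorm (randersMetric W) W where
  unit x v h := by
    rw [randersMetric_eq_iff ((hW x).trans_lt hw), one_smul, add_sub_cancel_right]
    exact h
  le := by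
    have h1w : 0 < 1 - w := sub_pos.2 hw
    -- What is needed of `C` is `(C + 1) * w ≤ C`: an error in the clock also changes the time bound
    -- that multiplies the wind.
    refine ⟨1 / (1 - w), w, by positivity, hw0, hw, fun x v e κ hκ => ?_⟩
    refine randersMetric_le ((hW x).trans_lt hw) ?_
    unfold riemannianNorm
    set C := 1 / (1 - w) with hC
    have hC1 : C * (1 - w) = 1 := by rw [hC]; field_simp
    have hC0 : 0 < C := by positivity
    have h1 : v + (‖v‖ + e + κ) • W x - (‖v‖ + C * |e| + w * κ) • W x =
        v - (C * |e| + w * κ - e - κ) • W x := by module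
    have h2 := norm_sub_smul_le v (W x) (C * |e| + w * κ - e - κ) 0
    rw [zero_smul, sub_zero, sub_zero] at h2
    have h3 : |C * |e| + w * κ - e - κ| ≤ (C + 1) * |e| + (1 - w) * κ := by
      have := mul_nonneg h1w.le hκ
      rw [abs_le]
      constructor <;> nlinarith [neg_abs_le e, le_abs_self e, abs_nonneg e]
    have h4 : |C * |e| + w * κ - e - κ| * ‖W x‖ ≤ ((C + 1) * |e| + (1 - w) * κ) * w :=
      mul_le_mul h3 (hW x) (norm_nonneg _) ((abs_nonneg _).trans h3)
    have h5 : (C + 1) * w ≤ C := by nlinarith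
    have h6 := mul_le_mul_of_nonneg_right h5 (abs_nonneg e)
    have h7 : 0 ≤ w * w * κ := by positivity
    rw [h1]
    linarith

lemma isNavigation_riemannianNorm {w : ℝ} (hw0 : 0 ≤ w) (hw : w < 1) (hW : ∀ x, ‖W x‖ ≤ w) :
    IsNavigation (randersMetric W) riemannianNorm (fun x => -W x) where
  unit x v h := by
    rw [randersMetric_eq_iff ((hW x).trans_lt hw), one_smul] at h
    rwa [riemannianNorm, ← sub_eq_add_neg]
  le := by
    refine ⟨1, w, zero_le_one, hw0, hw, fun x v e κ hκ => ?_⟩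
    unfold riemannianNorm
    set F := randersMetric W x v with hF
    have h1 := norm_sub_smul_le v (W x) (F + e + κ) F
    rw [hF, norm_sub_randersMetric_smul ((hW x).trans_lt hw), ← hF] at h1
    rw [smul_neg, ← sub_eq_add_neg]
    have h2 : |F + e + κ - F| ≤ |e| + κ := by
      rw [show F + e + κ - F = e + κ by ring]
      exact (abs_add_le _ _).trans (by rw [abs_of_nonneg hκ])
    have h3 : |F + e + κ - F| * ‖W x‖ ≤ (|e| + κ) * w :=
      mul_le_mul h2 (hW x) (norm_nonneg _) ((abs_nonneg _).trans h2)
    have h4 : |e| * w ≤ |e| * 1 := mul_le_mul_of_nonneg_left hw.le (abs_nonneg e)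
    linarith

variable [IsManifold 𝓘(ℝ, ℂ) ∞ M] {ψ : ℝ → M → M}

lemma isInvariantUnder_riemannianNorm
    [IsContMDiffRiemannianBundle 𝓘(ℝ, ℂ) ∞ ℂ (fun x : M => TangentSpace 𝓘(ℝ, ℂ) x)]
    (hψ : IsIsometricFlow ψ W) :
    IsInvariantUnder ψ (riemannianNorm : (x : M) → TangentSpace 𝓘(ℝ, ℂ) x → ℝ) where
  continuous := by
    have h : Continuous fun v : TangentBundle 𝓘(ℝ, ℂ) M =>
      (⟨v.1, v.2⟩ : TangentBundle 𝓘(ℝ, ℂ) M) := continuous_id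
    simpa only [riemannianNorm, norm_eq_sqrt_real_inner] using (Continuous.inner_bundle h h).sqrt
  invariant s x v := hψ.preservesMetric s x v

lemma isInvariantUnder_randersMetric
    [IsContMDiffRiemannianBundle 𝓘(ℝ, ℂ) ∞ ℂ (fun x : M => TangentSpace 𝓘(ℝ, ℂ) x)]
    (hψ : IsIsometricFlow ψ W) (hW : ∀ x, ‖W x‖ < 1) :
    IsInvariantUnder ψ (randersMetric W) where
  continuous := by
    have h : Continuous fun v : TangentBundle 𝓘(ℝ, ℂ) M =>
      (⟨v.1, v.2⟩ : TangentBundle 𝓘(ℝ, ℂ) M) := continuous_id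
    have hWc : Continuous fun v : TangentBundle 𝓘(ℝ, ℂ) M =>
      (⟨v.1, W v.1⟩ : TangentBundle 𝓘(ℝ, ℂ) M) :=
      hψ.continuous_field.comp (FiberBundle.continuous_proj ℂ _)
    have h1 := Continuous.inner_bundle h h
    have h2 := Continuous.inner_bundle hWc hWc
    have h3 := Continuous.inner_bundle hWc h
    simp only [randersMetric, ← real_inner_self_eq_norm_sq]
    refine Continuous.div ?_ (continuous_const.sub h2) fun v => ?_
    · exact (((continuous_const.sub h2).mul h1).add (h3.pow 2)).sqrt.sub h3
    · rw [real_inner_self_eq_norm_sq]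
      nlinarith [hW v.1, norm_nonneg (W v.1)]
  invariant s x v := by
    -- The navigation equation involves only the norm and `W`, both preserved by the flow.
    rw [randersMetric_eq_iff (hW _), ← hψ.mfderiv_field, ← ContinuousLinearMap.map_smul,
      ← ContinuousLinearMap.map_sub, hψ.preservesMetric]
    exact norm_sub_randersMetric_smul (hW x) v

/-- Compactness turns the pointwise bound into the uniform `w < 1` that `IsNavigation.le` demands.
-/
lemma exists_norm_field_le [CompactSpace M] [Nonempty M]
    [IsContMDiffRiemannianBundle 𝓘(ℝ, ℂ) ∞ ℂ (fun x : M => TangentSpace 𝓘(ℝ, ℂ) x)]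
    (hψ : IsIsometricFlow ψ W) (hW : ∀ x, ‖W x‖ < 1) :
    ∃ w : ℝ, 0 ≤ w ∧ w < 1 ∧ ∀ x, ‖W x‖ ≤ w := by
  have h : Continuous fun x => ‖W x‖ :=
    (isInvariantUnder_riemannianNorm hψ).continuous.comp hψ.continuous_field
  obtain ⟨x, -, hx⟩ := isCompact_univ.exists_isMaxOn univ_nonempty h.continuousOn
  exact ⟨‖W x‖, norm_nonneg _, hW x, fun y => hx (mem_univ y)⟩

/-- Zermelo navigation with an isometric flow of speed less than one. -/
lemma isUnitSpeedGeodesic_randersMetric_iff [CompactSpace M] [Nonempty M]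
    [IsContMDiffRiemannianBundle 𝓘(ℝ, ℂ) ∞ ℂ (fun x : M => TangentSpace 𝓘(ℝ, ℂ) x)]
    (hψ : IsIsometricFlow ψ W) (hψ' : IsIsometricFlow (fun s => ψ (-s)) (fun x => -W x))
    (hW : ∀ x, ‖W x‖ < 1) {P γ : ℝ → M} {J : Set ℝ} (hJ : IsOpen J) (hJc : J.OrdConnected)
    (hP : ∀ s ∈ J, P s = ψ s (γ s)) :
    IsUnitSpeedGeodesic (randersMetric W) P J ↔ IsUnitSpeedGeodesic riemannianNorm γ J := by
  obtain ⟨w, hw0, hw, hWw⟩ := exists_norm_field_le hψ hW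
  have hN := isNavigation_randersMetric hw0 hw hWw
  have hN' := isNavigation_riemannianNorm hw0 hw hWw
  constructor
  · intro h
    refine IsUnitSpeedGeodesic.moved hN' hψ' (by simpa only [neg_neg] using hN)
      (by simpa only [neg_neg] using hψ) ?_ ?_ hJ hJc h fun s hs => ?_
    · have := isInvariantUnder_randersMetric hψ hW
      exact ⟨this.continuous, fun s => this.invariant (-s)⟩
    · exact isInvariantUnder_riemannianNorm hψ'
    · rw [hP s hs, ← hψ.add, neg_add_cancel, hψ.zero]
  · exact fun h => IsUnitSpeedGeodesic.moved hN hψ hN' hψ' (isInvariantUnder_riemannianNorm hψ)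
      (isInvariantUnder_randersMetric hψ hW) hJ hJc h hP

end Randers

lemma polarRotation_polarPoint {M : Type*} [MetricSpace M] [ChartedSpace ℂ M]
    [IsManifold 𝓘(ℝ, ℂ) ∞ M] [RiemannianBundle (fun x : M => TangentSpace 𝓘(ℝ, ℂ) x)]
    {p q : M} {E : OpenPartialHomeomorph M ℂ} (hE : IsGeodesicPolarChart p q E) {r : ℝ}
    (hr : r ∈ Ioo 0 (dist p q)) (θ t : ℝ) :
    polarRotation E t (polarPoint E r θ) = polarPoint E r (θ + t) := by
  have h : ‖(r : ℂ) * Complex.exp (θ * Complex.I)‖ < dist p q := by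
    rw [norm_mul, Complex.norm_exp_ofReal_mul_I, mul_one, Complex.norm_real, Real.norm_eq_abs,
      abs_of_pos hr.1]
    exact hr.2
  have ht := hE.mem_target.2 h
  rw [polarRotation, polarPoint, if_pos (E.map_target ht), E.right_inv ht, polarPoint,
    mul_left_comm, ← Complex.exp_add]
  congr 3
  push_cast
  ring

end

theorem mainTheorem6 {M : Type*} [MetricSpace M] [ChartedSpace ℂ M] [IsManifold 𝓘(ℝ, ℂ) ∞ M]
    [RiemannianBundle (fun x : M => TangentSpace 𝓘(ℝ, ℂ) x)]
    [IsContMDiffRiemannianBundle 𝓘(ℝ, ℂ) ∞ ℂ (fun x : M => TangentSpace 𝓘(ℝ, ℂ) x)]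
    [IsRiemannianManifold 𝓘(ℝ, ℂ) M]
    -- a 2-sphere of revolution with a pair of poles `p`, `q`,
    -- and geodesic polar coordinates around `p`
    (p q : M) (hM : IsSphereOfRevolution p)
    (E : OpenPartialHomeomorph M ℂ) (hE : IsGeodesicPolarChart p q E)
    (hqp : ∃ E' : OpenPartialHomeomorph M ℂ, IsGeodesicPolarChart q p E')
    -- the wind `W = μ ∂/∂θ`, where `|μ| m < 1` for `m = √h(∂/∂θ, ∂/∂θ)`
    (μ : ℝ) (hμ : ∀ x : M, |μ| * ‖angularField E x‖ < 1)
    (W : (x : M) → TangentSpace 𝓘(ℝ, ℂ) x) (hW : W = fun x => μ • angularField E x)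
    (φ : ℝ → M → M) (hφ : φ = fun s x => polarRotation E (μ * s) x) :
    -- `φ` is the flow of `W`
    (ContMDiff (𝓘(ℝ, ℝ).prod 𝓘(ℝ, ℂ)) 𝓘(ℝ, ℂ) ∞ (fun z : ℝ × M => φ z.1 z.2) ∧
      (∀ x, φ 0 x = x) ∧ (∀ x, IsMIntegralCurve (I := 𝓘(ℝ, ℂ)) (fun s => φ s x) W)) ∧
    -- `W` is a Killing field of `h`
    (∀ s, PreservesMetric (φ s)) ∧
    -- the `F`-geodesics are the `h`-geodesics carried along by the flow
    (∀ ε > 0, ∀ P : ℝ → M,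
      IsUnitSpeedGeodesic (randersMetric W) P (Ioo (-ε) ε) ↔
        ∃ γ : ℝ → M, IsUnitSpeedGeodesic riemannianNorm γ (Ioo (-ε) ε) ∧
          ∀ s ∈ Ioo (-ε) ε, P s = φ s (γ s)) ∧
    -- the same in polar coordinates, for curves that avoid the poles
    (∀ ε > 0, ∀ r θ : ℝ → ℝ, (∀ s ∈ Ioo (-ε) ε, r s ∈ Ioo 0 (dist p q)) →
      (IsUnitSpeedGeodesic (randersMetric W) (fun s => polarPoint E (r s) (θ s + μ * s))
          (Ioo (-ε) ε) ↔
        IsUnitSpeedGeodesic riemannianNorm (fun s => polarPoint E (r s) (θ s))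
          (Ioo (-ε) ε))) := by
  have hflow := isIsometricFlow_polarRotation hM hE hqp.choose_spec
  have hψ : IsIsometricFlow φ W := by
    rw [hφ, hW]
    exact hflow μ
  have hψ' : IsIsometricFlow (fun s => φ (-s)) (fun x => -W x) := by
    have h := hflow (-μ)
    subst hφ hW
    simpa only [neg_smul, neg_mul, mul_neg] using h
  have hW1 : ∀ x, ‖W x‖ < 1 := by
    intro x
    rw [hW, norm_smul, Real.norm_eq_abs]
    exact hμ x
  have : CompactSpace M := hM.compact
  have : Nonempty M := ⟨p⟩
  have hiff := fun (ε : ℝ) (P γ : ℝ → M) => isUnitSpeedGeodesic_randersMetric_iff hψ hψ' hW1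
    (P := P) (γ := γ) (isOpen_Ioo (a := -ε) (b := ε)) ordConnected_Ioo
  refine ⟨⟨hψ.smooth, hψ.zero, hψ.isMIntegralCurve⟩, hψ.preservesMetric, fun ε _ P => ⟨fun h => ?_,
    fun ⟨γ, hγ, hP⟩ => (hiff ε P γ hP).2 hγ⟩, fun ε _ r θ hr => hiff ε _ _ fun s hs => ?_⟩
  -- The `h`-geodesic is recovered from `P` by undoing the flow.
  · have hP : ∀ s ∈ Ioo (-ε) ε, P s = φ s (φ (-s) (P s)) := fun s _ => by
      rw [← hψ.add, add_neg_cancel, hψ.zero]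
    exact ⟨_, (hiff ε P _ hP).1 h, hP⟩
  · rw [hφ]
    exact (polarRotation_polarPoint hE (hr s hs) _ _).symm
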